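/- Let $\lambda$ be a regular cardinal. Call an object $C$ of a category $V$ *connected* if the representable $V(C,-)$ preserves all small coproducts (including the empty one), and *$\lambda$-presentable* if $V(C,-)$ preserves all $\lambda$-filtered colimits. A category $J$ is *$\lambda$-c-filtered* if every functor $K\to J$ from a connected (in particular non-empty) category $K$ with fewer than $\lambda$ arrows admits a cocone. A locally small category $V$ is *locally $\lambda$-c-presentable* if it is cocomplete and there is a (small) set $\mathcal S$ of objects of $V$ that are both connected and $\lambda$-presentable, such that every object of $V$ is the colimit of a small $\lambda$-c-filtered diagram of objects of $\mathcal S$; for $\lambda=\aleph_0$ one says *locally finitely c-presentable*. For $0\le n\le\omega$, let $\mathcal T_{\le n}$ be the monad on the category $\widehat{\mathbb G}_{\le n}$ of $n$-globular sets (presheaves on the category of globes of dimension $\le n$) induced by the adjunction between the forgetful functor from strict $n$-categories and the free strict $n$-category functor. An *$n$-operad* is a monad $A$ on $\widehat{\mathbb G}_{\le n}$ together with a morphism of monads $A\to\mathcal T_{\le n}$ all of whose naturality squares are pullbacks; its algebras are the algebras of the monad $A$. **Theorem.** (1) If $V$ is locally $\lambda$-c-presentable and $T$ is a monad on $V$ whose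 underlying endofunctor preserves $\lambda$-filtered colimits and small coproducts, then the category $V^T$ of Eilenberg–Moore algebras is locally $\lambda$-c-presentable. (2) In particular, for every $0\le n\le\omega$ and every $n$-operad $A$, the category of algebras of $A$ is locally finitely c-presentable. -/

import Mathlib

open CategoryTheory Limits Opposite

universe w v u

/-! ### Connected objects and locally `κ`-c-presentable categories -/

namespace CPres

/-- An object `C` is connected when the representable `V(C, -)` preserves (small) coproducts,
including the empty one. -/
def IsConnectedObject {V : Type u} [Category.{w} V] (C : V) : Prop :=
  ∀ ι : Type w, PreservesColimitsOfShape (Discrete ι) (coyoneda.obj (op C))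

/-- A functor preserves (small) coproducts. -/
def PreservesSmallCoproducts {V : Type u} [Category.{w} V] {W : Type v} [Category.{w} W]
    (F : V ⥤ W) : Prop :=
  ∀ ι : Type w, PreservesColimitsOfShape (Discrete ι) F

/-- A category `J` is `κ`-c-filtered when every functor to `J` from a `κ`-small connected
(in particular nonempty) category admits a cocone. -/
class IsCardinalCFiltered (J : Type u) [Category.{v} J] (κ : Cardinal.{w}) [Fact κ.IsRegular] :
    Prop where
  nonempty_cocone {A : Type w} [SmallCategory A] [IsConnected A] (F : A ⥤ J)
    (hA : HasCardinalLT (Arrow A) κ) : Nonempty (Cocone F)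

/-- A locally small category `V` (its hom-sets live in `Type w`, the universe of small sets) is
locally `κ`-c-presentable when it is cocomplete and has a small set `S` of objects which are
connected and `κ`-presentable, such that every object of `V` is the colimit of a small
`κ`-c-filtered diagram of objects of `S`. -/
class IsLocallyCPresentable (V : Type u) [Category.{w} V] (κ : Cardinal.{w})
    [Fact κ.IsRegular] : Prop where
  cocomplete : HasColimitsOfSize.{w, w} V
  exists_generator : ∃ S : ObjectProperty V, ObjectProperty.Small.{w} S ∧
    (∀ X, S X → IsConnectedObject X ∧ IsCardinalPresentable X κ) ∧
    ∀ X : V, ∃ (J : Type w) (_ : SmallCategory J),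
      IsCardinalCFiltered J κ ∧ Nonempty (S.ColimitOfShape J X)

/-- Locally finitely c-presentable: locally `ℵ₀`-c-presentable. -/
def IsLocallyFinitelyCPresentable (V : Type u) [Category.{w} V] : Prop :=
  haveI := Cardinal.fact_isRegular_aleph0.{w}
  IsLocallyCPresentable V Cardinal.aleph0.{w}

end CPres

/-! ### `n`-globular sets, for `0 ≤ n ≤ ω` -/

namespace Glob

/-- The objects of the globe category `𝔾_{≤n}`: natural numbers `k ≤ n`
(with `n = ⊤` standing for `ω`). -/
@[ext]
structure Globe (n : ℕ∞) where
  dim : ℕ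
  dim_le : (dim : ℕ∞) ≤ n

variable {n : ℕ∞}

/-- The morphisms of the globe category. For `k < l` there are exactly two morphisms `k ⟶ l`,
the inclusions of the `k`-globe as the `k`-dimensional source (sign `-1`) and as the
`k`-dimensional target (sign `1`) of the `l`-globe; for `k = l` there is only the identity
(sign `0`); for `k > l` there is none. -/
@[ext]
structure Globe.Hom (k l : Globe n) where
  sign : SignType
  cond : (sign = 0 ∧ k.dim = l.dim) ∨ (sign ≠ 0 ∧ k.dim < l.dim)

/-- Composition obeys the (co)globular identities: a composite of two non-identity maps is the
source or target inclusion according to the first of them. -/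
instance : Category (Globe n) where
  Hom := Globe.Hom
  id k := ⟨0, Or.inl ⟨rfl, rfl⟩⟩
  comp f g := ⟨if f.sign = 0 then g.sign else f.sign, by
    rcases f.cond with ⟨h, e⟩ | ⟨h, e⟩ <;> rcases g.cond with ⟨h', e'⟩ | ⟨h', e'⟩ <;>
      simp [h, h'] <;> omega⟩
  id_comp f := by apply Globe.Hom.ext; simp
  comp_id f := by
    apply Globe.Hom.ext
    by_cases h : f.sign = 0 <;> simp [h]
  assoc f g h := by
    apply Globe.Hom.ext
    by_cases h : f.sign = 0 <;> simp [h]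

/-- The inclusion of the `k`-globe as the `k`-source of the `l`-globe. -/
def srcIncl {k l : Globe n} (h : k.dim < l.dim) : k ⟶ l :=
  Globe.Hom.mk (-1) (Or.inr ⟨by decide, h⟩)

/-- The inclusion of the `k`-globe as the `k`-target of the `l`-globe. -/
def tgtIncl {k l : Globe n} (h : k.dim < l.dim) : k ⟶ l :=
  Globe.Hom.mk 1 (Or.inr ⟨by decide, h⟩)

/-- The category of `n`-globular sets: presheaves on the globe category. -/
abbrev NGlob (n : ℕ∞) := (Globe n)ᵒᵖ ⥤ Type u

/-- The set of `k`-cells. -/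
abbrev NGlob.cell (X : NGlob.{u} n) (k : Globe n) : Type u := X.obj (op k)

/-- The `k`-dimensional source of an `l`-cell. -/
def NGlob.src (X : NGlob.{u} n) {k l : Globe n} (h : k.dim < l.dim) (x : X.cell l) : X.cell k :=
  X.map (srcIncl h).op x

/-- The `k`-dimensional target of an `l`-cell. -/
def NGlob.tgt (X : NGlob.{u} n) {k l : Globe n} (h : k.dim < l.dim) (x : X.cell l) : X.cell k :=
  X.map (tgtIncl h).op x

/-! ### Strict `n`-categories -/

/-- A (small) strict `n`-category, `0 ≤ n ≤ ω`: an `n`-globular set with, for `k < l`, identity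
`l`-cells on `k`-cells, and composites along `k`-cells of those pairs `x`, `y` of `l`-cells for
which the `k`-target of `x` is the `k`-source of `y`. Compositions are written in diagrammatic
order. The composability hypotheses `e`, `e'`, ... in the axioms are in each case the ones needed
for both sides to make sense; those beyond the evident ones follow from the globular identities
and the axioms on sources and targets. -/
structure StrictNCat (n : ℕ∞) where
  /-- the underlying globular set -/
  cells : NGlob.{u} n
  /-- the identity `l`-cell on a `k`-cell -/
  ident {k l : Globe n} (h : k.dim < l.dim) (x : cells.cell k) : cells.cell l
  /-- the composite of `l`-cells along a `k`-cell -/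
  comp {k l : Globe n} (h : k.dim < l.dim) (x y : cells.cell l)
    (e : cells.tgt h x = cells.src h y) : cells.cell l
  src_ident {k l : Globe n} (h : k.dim < l.dim) (x : cells.cell k) :
    cells.src h (ident h x) = x
  tgt_ident {k l : Globe n} (h : k.dim < l.dim) (x : cells.cell k) :
    cells.tgt h (ident h x) = x
  ident_ident {k l m : Globe n} (h : k.dim < l.dim) (h' : l.dim < m.dim) (x : cells.cell k) :
    ident h' (ident h x) = ident (h.trans h') x
  src_comp {k l : Globe n} (h : k.dim < l.dim) (x y : cells.cell l)
    (e : cells.tgt h x = cells.src h y) : cells.src h (comp h x y e) = cells.src h x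
  tgt_comp {k l : Globe n} (h : k.dim < l.dim) (x y : cells.cell l)
    (e : cells.tgt h x = cells.src h y) : cells.tgt h (comp h x y e) = cells.tgt h y
  src_comp_of_lt {k j l : Globe n} (h : k.dim < j.dim) (h' : j.dim < l.dim) (x y : cells.cell l)
    (e : cells.tgt (h.trans h') x = cells.src (h.trans h') y)
    (e' : cells.tgt h (cells.src h' x) = cells.src h (cells.src h' y)) :
    cells.src h' (comp (h.trans h') x y e) = comp h (cells.src h' x) (cells.src h' y) e'
  tgt_comp_of_lt {k j l : Globe n} (h : k.dim < j.dim) (h' : j.dim < l.dim) (x y : cells.cell l)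
    (e : cells.tgt (h.trans h') x = cells.src (h.trans h') y)
    (e' : cells.tgt h (cells.tgt h' x) = cells.src h (cells.tgt h' y)) :
    cells.tgt h' (comp (h.trans h') x y e) = comp h (cells.tgt h' x) (cells.tgt h' y) e'
  /-- associativity -/
  assoc {k l : Globe n} (h : k.dim < l.dim) (x y z : cells.cell l)
    (e₁ : cells.tgt h x = cells.src h y) (e₂ : cells.tgt h y = cells.src h z)
    (e₃ : cells.tgt h (comp h x y e₁) = cells.src h z)
    (e₄ : cells.tgt h x = cells.src h (comp h y z e₂)) :
    comp h (comp h x y e₁) z e₃ = comp h x (comp h y z e₂) e₄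
  /-- left unit law -/
  ident_comp {k l : Globe n} (h : k.dim < l.dim) (x : cells.cell l)
    (e : cells.tgt h (ident h (cells.src h x)) = cells.src h x) :
    comp h (ident h (cells.src h x)) x e = x
  /-- right unit law -/
  comp_ident {k l : Globe n} (h : k.dim < l.dim) (x : cells.cell l)
    (e : cells.tgt h x = cells.src h (ident h (cells.tgt h x))) :
    comp h x (ident h (cells.tgt h x)) e = x
  /-- binary interchange -/
  interchange {k j l : Globe n} (h : k.dim < j.dim) (h' : j.dim < l.dim)
    (x y x' y' : cells.cell l)
    (e₁ : cells.tgt h' x = cells.src h' y) (e₂ : cells.tgt h' x' = cells.src h' y')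
    (e₃ : cells.tgt (h.trans h') x = cells.src (h.trans h') x')
    (e₄ : cells.tgt (h.trans h') y = cells.src (h.trans h') y')
    (e₅ : cells.tgt (h.trans h') (comp h' x y e₁) = cells.src (h.trans h') (comp h' x' y' e₂))
    (e₆ : cells.tgt h' (comp (h.trans h') x x' e₃) = cells.src h' (comp (h.trans h') y y' e₄)) :
    comp (h.trans h') (comp h' x y e₁) (comp h' x' y' e₂) e₅ =
      comp h' (comp (h.trans h') x x' e₃) (comp (h.trans h') y y' e₄) e₆
  /-- nullary interchange -/
  ident_comp_ident {k j l : Globe n} (h : k.dim < j.dim) (h' : j.dim < l.dim)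
    (x y : cells.cell j) (e : cells.tgt h x = cells.src h y)
    (e' : cells.tgt (h.trans h') (ident h' x) = cells.src (h.trans h') (ident h' y)) :
    comp (h.trans h') (ident h' x) (ident h' y) e' = ident h' (comp h x y e)

/-- A strict `n`-functor: a map of globular sets preserving identities and composites. -/
@[ext]
structure StrictNCat.Hom (C D : StrictNCat.{u} n) where
  map : C.cells ⟶ D.cells
  map_ident {k l : Globe n} (h : k.dim < l.dim) (x : C.cells.cell k) :
    map.app (op l) (C.ident h x) = D.ident h (map.app (op k) x)
  map_comp {k l : Globe n} (h : k.dim < l.dim) (x y : C.cells.cell l)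
    (e : C.cells.tgt h x = C.cells.src h y)
    (e' : D.cells.tgt h (map.app (op l) x) = D.cells.src h (map.app (op l) y)) :
    map.app (op l) (C.comp h x y e) = D.comp h (map.app (op l) x) (map.app (op l) y) e'

lemma NGlob.map_src {X Y : NGlob.{u} n} (f : X ⟶ Y) {k l : Globe n} (h : k.dim < l.dim)
    (x : X.cell l) : f.app (op k) (X.src h x) = Y.src h (f.app (op l) x) :=
  NatTrans.naturality_apply f (srcIncl h).op x

lemma NGlob.map_tgt {X Y : NGlob.{u} n} (f : X ⟶ Y) {k l : Globe n} (h : k.dim < l.dim)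
    (x : X.cell l) : f.app (op k) (X.tgt h x) = Y.tgt h (f.app (op l) x) :=
  NatTrans.naturality_apply f (tgtIncl h).op x

lemma NGlob.map_composable {X Y : NGlob.{u} n} (f : X ⟶ Y) {k l : Globe n} (h : k.dim < l.dim)
    {x y : X.cell l} (e : X.tgt h x = X.src h y) :
    Y.tgt h (f.app (op l) x) = Y.src h (f.app (op l) y) := by
  rw [← NGlob.map_src, ← NGlob.map_tgt, e]

/-- The category of strict `n`-categories and strict `n`-functors. -/
instance : Category (StrictNCat.{u} n) where
  Hom := StrictNCat.Hom
  id C := ⟨𝟙 _, by simp, by simp⟩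
  comp {C D E} F G := ⟨F.map ≫ G.map, by simp [F.map_ident, G.map_ident], by
    intro k l h x y e e'
    have e₁ := NGlob.map_composable F.map h e
    have e₂ := NGlob.map_composable G.map h e₁
    simp only [NatTrans.comp_app_apply]
    rw [F.map_comp h x y e e₁, G.map_comp h _ _ e₁ e₂]⟩

/-- The functor from strict `n`-categories to `n`-globular sets. -/
def StrictNCat.forget (n : ℕ∞) : StrictNCat.{u} n ⥤ NGlob.{u} n where
  obj C := C.cells
  map F := F.map

/-! ### Free strict `n`-categories -/

namespace Free

/-- Formal expressions in the operations of strict `n`-categories, with variables in `X`. -/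
inductive Term (X : NGlob.{u} n) : Globe n → Type u
  | var {k : Globe n} (x : X.cell k) : Term X k
  | face {k l : Globe n} (f : k ⟶ l) (t : Term X l) : Term X k
  | ident {k l : Globe n} (h : k.dim < l.dim) (t : Term X k) : Term X l
  | comp {k l : Globe n} (h : k.dim < l.dim) (s t : Term X l) : Term X l

variable {X : NGlob.{u} n}

open Classical in
/-- The value of an expression in a strict `n`-category `C`, for a given interpretation of the
variables; undefined if a composite of non-composable cells occurs. -/
noncomputable def eval (C : StrictNCat.{u} n) (φ : X ⟶ C.cells) :
    {k : Globe n} → Term X k → Option (C.cells.cell k)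
  | _, .var x => some (φ.app _ x)
  | _, .face f t => (eval C φ t).map (fun x => C.cells.map f.op x)
  | _, .ident h t => (eval C φ t).map (C.ident h)
  | _, .comp h s t => (eval C φ s).bind fun x => (eval C φ t).bind fun y =>
      if e : C.cells.tgt h x = C.cells.src h y then some (C.comp h x y e) else none

lemma eval_hom {C D : StrictNCat.{u} n} (φ : X ⟶ C.cells) (F : C ⟶ D) {k : Globe n}
    (t : Term X k) : ∀ x, eval C φ t = some x →
      eval D (φ ≫ (StrictNCat.forget n).map F) t = some ((StrictNCat.Hom.map F).app _ x) := by
  induction t with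
  | var x =>
    intro y hy
    simp only [eval, Option.some.injEq] at hy ⊢
    subst hy
    rfl
  | face f t ih =>
    intro y hy
    simp only [eval, Option.map_eq_some_iff] at hy ⊢
    obtain ⟨a, ha, rfl⟩ := hy
    exact ⟨_, ih a ha, (NatTrans.naturality_apply (StrictNCat.Hom.map F) f.op a).symm⟩
  | ident h t ih =>
    intro y hy
    simp only [eval, Option.map_eq_some_iff] at hy ⊢
    obtain ⟨a, ha, rfl⟩ := hy
    exact ⟨_, ih a ha, (StrictNCat.Hom.map_ident F h a).symm⟩
  | comp h s t ihs iht =>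
    intro y hy
    simp only [eval, Option.bind_eq_some_iff] at hy ⊢
    obtain ⟨a, ha, b, hb, hy⟩ := hy
    refine ⟨_, ihs a ha, _, iht b hb, ?_⟩
    split_ifs at hy with e
    have e' := NGlob.map_composable (StrictNCat.Hom.map F) h e
    rw [dif_pos e']
    simp only [Option.some.injEq] at hy ⊢
    subst hy
    exact (StrictNCat.Hom.map_comp F h a b e e').symm

/-- An expression is valid if it has a value under every interpretation. -/
def Valid {k : Globe n} (t : Term X k) : Prop :=
  ∀ (C : StrictNCat.{u} n) (φ : X ⟶ C.cells), ∃ x, eval C φ t = some x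

/-- Two valid expressions are identified if they agree under every interpretation. -/
def rel (X : NGlob.{u} n) (k : Globe n) : Setoid {t : Term X k // Valid t} where
  r s t := ∀ (C : StrictNCat.{u} n) (φ : X ⟶ C.cells), eval C φ s.1 = eval C φ t.1
  iseqv := ⟨fun _ _ _ => rfl, fun h C φ => (h C φ).symm,
    fun h h' C φ => (h C φ).trans (h' C φ)⟩

/-- The `k`-cells of the free strict `n`-category on `X`. -/
def Cell (X : NGlob.{u} n) (k : Globe n) : Type u := Quotient (rel X k)

/-- A representing expression. -/
noncomputable def Cell.term {k : Globe n} (q : Cell X k) : Term X k := (Quotient.out q).1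

lemma Cell.valid {k : Globe n} (q : Cell X k) : Valid q.term := (Quotient.out q).2

/-- The value of a cell under an interpretation. -/
noncomputable def Cell.val {k : Globe n} (q : Cell X k) (C : StrictNCat.{u} n)
    (φ : X ⟶ C.cells) : C.cells.cell k := (q.valid C φ).choose

lemma Cell.eval_term {k : Globe n} (q : Cell X k) (C : StrictNCat.{u} n) (φ : X ⟶ C.cells) :
    eval C φ q.term = some (q.val C φ) := (q.valid C φ).choose_spec

lemma Cell.ext {k : Globe n} {q r : Cell X k}
    (h : ∀ (C : StrictNCat.{u} n) (φ : X ⟶ C.cells), q.val C φ = r.val C φ) : q = r := by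
  rw [← Quotient.out_eq q, ← Quotient.out_eq r]
  refine Quotient.sound fun C φ => ?_
  have h₁ := q.eval_term C φ
  have h₂ := r.eval_term C φ
  rw [h C φ] at h₁
  exact h₁.trans h₂.symm

/-- The cell given by an expression with prescribed values. -/
def Cell.mk {k : Globe n} (t : Term X k)
    (v : ∀ (C : StrictNCat.{u} n), (X ⟶ C.cells) → C.cells.cell k)
    (h : ∀ C φ, eval C φ t = some (v C φ)) : Cell X k :=
  Quotient.mk (rel X k) ⟨t, fun C φ => ⟨_, h C φ⟩⟩

lemma Cell.val_mk {k : Globe n} (t : Term X k)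
    (v : ∀ (C : StrictNCat.{u} n), (X ⟶ C.cells) → C.cells.cell k)
    (h : ∀ C φ, eval C φ t = some (v C φ)) (C : StrictNCat.{u} n) (φ : X ⟶ C.cells) :
    (Cell.mk t v h).val C φ = v C φ := by
  have h₁ := (Cell.mk t v h).eval_term C φ
  have h₂ : eval C φ (Cell.mk t v h).term = eval C φ t :=
    Quotient.mk_out (s := rel X k) ⟨t, fun C φ => ⟨_, h C φ⟩⟩ C φ
  rw [h₂, h C φ] at h₁
  exact (Option.some.inj h₁).symm

/-- Faces of cells. -/
noncomputable def Cell.face {k l : Globe n} (f : k ⟶ l) (q : Cell X l) : Cell X k :=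
  .mk (.face f q.term) (fun C φ => C.cells.map f.op (q.val C φ))
    (fun C φ => by simp [eval, q.eval_term])

@[simp] lemma Cell.val_face {k l : Globe n} (f : k ⟶ l) (q : Cell X l) (C : StrictNCat.{u} n)
    (φ : X ⟶ C.cells) : (q.face f).val C φ = C.cells.map f.op (q.val C φ) := Cell.val_mk ..

/-- The underlying globular set of the free strict `n`-category on `X`. -/
noncomputable def cells (X : NGlob.{u} n) : NGlob.{u} n where
  obj k := Cell X k.unop
  map f := TypeCat.ofHom fun q => q.face f.unop
  map_id k := by
    ext q
    exact Cell.ext fun C φ => by simp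
  map_comp f g := by
    ext q
    exact Cell.ext fun C φ => by simp

/-- The value of a cell of the free strict `n`-category under an interpretation. -/
noncomputable def val {k : Globe n} (q : (cells X).cell k) (C : StrictNCat.{u} n)
    (φ : X ⟶ C.cells) : C.cells.cell k := Cell.val q C φ

/-- A representing expression. -/
noncomputable def term {k : Globe n} (q : (cells X).cell k) : Term X k := Cell.term q

lemma eval_term {k : Globe n} (q : (cells X).cell k) (C : StrictNCat.{u} n)
    (φ : X ⟶ C.cells) : eval C φ (term q) = some (val q C φ) := Cell.eval_term ..

lemma ext {k : Globe n} {q r : (cells X).cell k}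
    (h : ∀ (C : StrictNCat.{u} n) (φ : X ⟶ C.cells), val q C φ = val r C φ) : q = r :=
  Cell.ext h

lemma val_map {k l : Globe n} (f : k ⟶ l) (q : (cells X).cell l) (C : StrictNCat.{u} n)
    (φ : X ⟶ C.cells) : val ((cells X).map f.op q) C φ = C.cells.map f.op (val q C φ) :=
  Cell.val_face ..

lemma val_src {k l : Globe n} (h : k.dim < l.dim) (q : (cells X).cell l) (C : StrictNCat.{u} n)
    (φ : X ⟶ C.cells) : val ((cells X).src h q) C φ = C.cells.src h (val q C φ) :=
  val_map ..

lemma val_tgt {k l : Globe n} (h : k.dim < l.dim) (q : (cells X).cell l) (C : StrictNCat.{u} n)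
    (φ : X ⟶ C.cells) : val ((cells X).tgt h q) C φ = C.cells.tgt h (val q C φ) :=
  val_map ..

lemma val_composable {k l : Globe n} {h : k.dim < l.dim} {q r : (cells X).cell l}
    (e : (cells X).tgt h q = (cells X).src h r) (C : StrictNCat.{u} n) (φ : X ⟶ C.cells) :
    C.cells.tgt h (val q C φ) = C.cells.src h (val r C φ) := by
  rw [← val_tgt, ← val_src, e]

/-- The generating cells. -/
def var {k : Globe n} (x : X.cell k) : (cells X).cell k :=
  Cell.mk (.var x) (fun _ φ => φ.app _ x) (fun _ _ => rfl)

/-- Identity cells. -/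
noncomputable def ident {k l : Globe n} (h : k.dim < l.dim) (q : (cells X).cell k) :
    (cells X).cell l :=
  Cell.mk (.ident h (term q)) (fun C φ => C.ident h (val q C φ))
    (fun C φ => by simp [eval, eval_term])

/-- Composite cells. -/
noncomputable def comp {k l : Globe n} (h : k.dim < l.dim) (q r : (cells X).cell l)
    (e : (cells X).tgt h q = (cells X).src h r) : (cells X).cell l :=
  Cell.mk (.comp h (term q) (term r))
    (fun C φ => C.comp h (val q C φ) (val r C φ) (val_composable e C φ))
    (fun C φ => by simp [eval, eval_term, val_composable e C φ])

lemma val_var {k : Globe n} (x : X.cell k) (C : StrictNCat.{u} n)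
    (φ : X ⟶ C.cells) : val (var x) C φ = φ.app _ x := Cell.val_mk ..

lemma val_ident {k l : Globe n} (h : k.dim < l.dim) (q : (cells X).cell k) (C : StrictNCat.{u} n)
    (φ : X ⟶ C.cells) : val (ident h q) C φ = C.ident h (val q C φ) := Cell.val_mk ..

lemma val_comp {k l : Globe n} (h : k.dim < l.dim) (q r : (cells X).cell l)
    (e : (cells X).tgt h q = (cells X).src h r) (C : StrictNCat.{u} n)
    (φ : X ⟶ C.cells) : val (comp h q r e) C φ =
      C.comp h (val q C φ) (val r C φ) (val_composable e C φ) := Cell.val_mk ..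

lemma comp_congr (C : StrictNCat.{u} n) {k l : Globe n} (h : k.dim < l.dim)
    {x x' y y' : C.cells.cell l} (e : C.cells.tgt h x = C.cells.src h y) (hx : x = x')
    (hy : y = y') : C.comp h x y e = C.comp h x' y' (by rw [← hx, ← hy, e]) := by
  subst hx hy
  rfl

/-- The free strict `n`-category on `X`. -/
noncomputable def strictNCat (X : NGlob.{u} n) : StrictNCat.{u} n where
  cells := cells X
  ident h q := Free.ident h q
  comp h q r e := Free.comp h q r e
  src_ident h q := Free.ext fun C φ => by rw [val_src, val_ident, C.src_ident]
  tgt_ident h q := Free.ext fun C φ => by rw [val_tgt, val_ident, C.tgt_ident]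
  ident_ident h h' q := Free.ext fun C φ => by simp only [val_ident, C.ident_ident]
  src_comp h q r e := Free.ext fun C φ => by rw [val_src, val_comp, C.src_comp, val_src]
  tgt_comp h q r e := Free.ext fun C φ => by rw [val_tgt, val_comp, C.tgt_comp, val_tgt]
  src_comp_of_lt h h' q r e e' := Free.ext fun C φ => by
    have := val_composable e' C φ
    simp only [val_src] at this
    rw [val_src, val_comp, val_comp, C.src_comp_of_lt h h' _ _ _ this]
    exact comp_congr C h _ (val_src ..).symm (val_src ..).symm
  tgt_comp_of_lt h h' q r e e' := Free.ext fun C φ => by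
    have := val_composable e' C φ
    simp only [val_tgt] at this
    rw [val_tgt, val_comp, val_comp, C.tgt_comp_of_lt h h' _ _ _ this]
    exact comp_congr C h _ (val_tgt ..).symm (val_tgt ..).symm
  assoc h x y z e₁ e₂ e₃ e₄ := Free.ext fun C φ => by
    have e₃' := val_composable e₃ C φ
    have e₄' := val_composable e₄ C φ
    simp only [val_comp] at e₃' e₄' ⊢
    exact C.assoc h _ _ _ _ _ e₃' e₄'
  ident_comp h x e := Free.ext fun C φ => by
    have e' := val_composable e C φ
    simp only [val_comp, val_ident, val_src] at e' ⊢
    exact C.ident_comp h _ e'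
  comp_ident h x e := Free.ext fun C φ => by
    have e' := val_composable e C φ
    simp only [val_comp, val_ident, val_tgt] at e' ⊢
    exact C.comp_ident h _ e'
  interchange h h' x y x' y' e₁ e₂ e₃ e₄ e₅ e₆ := Free.ext fun C φ => by
    have e₅' := val_composable e₅ C φ
    have e₆' := val_composable e₆ C φ
    simp only [val_comp] at e₅' e₆' ⊢
    exact C.interchange h h' _ _ _ _ _ _ _ _ e₅' e₆'
  ident_comp_ident h h' x y e e' := Free.ext fun C φ => by
    have e'' := val_composable e' C φ
    simp only [val_comp, val_ident] at e'' ⊢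
    exact C.ident_comp_ident h h' _ _ _ e''

/-- The inclusion of generators. -/
def unit (X : NGlob.{u} n) : X ⟶ (strictNCat X).cells where
  app k := TypeCat.ofHom fun x => var (k := k.unop) x
  naturality k l f := by
    ext x
    refine Free.ext (k := l.unop) fun C φ => ?_
    refine (val_var ..).trans (Eq.trans ?_ (val_map f.unop (var x) C φ).symm)
    rw [val_var]
    exact NatTrans.naturality_apply φ f x

/-- The strict `n`-functor induced by a map of globular sets. -/
noncomputable def desc (C : StrictNCat.{u} n) (φ : X ⟶ C.cells) : strictNCat X ⟶ C :=
  StrictNCat.Hom.mk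
    { app := fun k => TypeCat.ofHom fun q => val (k := k.unop) q C φ
      naturality := fun k l f => by
        ext q
        exact val_map f.unop q C φ }
    (fun h q => val_ident h q C φ)
    (fun h q r e _ => val_comp h q r e C φ)

lemma unit_desc (C : StrictNCat.{u} n) (φ : X ⟶ C.cells) :
    unit X ≫ (StrictNCat.forget n).map (desc C φ) = φ := by
  ext k x
  exact val_var (k := k.unop) x C φ

lemma desc_unique {C : StrictNCat.{u} n} {φ : X ⟶ C.cells} (F : strictNCat X ⟶ C)
    (hF : unit X ≫ (StrictNCat.forget n).map F = φ) : F = desc C φ := by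
  apply StrictNCat.Hom.ext
  ext k q
  obtain ⟨q', hq'⟩ := Cell.valid (k := k.unop) q (strictNCat X) (unit X)
  have key : ∀ (D : StrictNCat.{u} n) (ψ : X ⟶ D.cells) (G : strictNCat X ⟶ D),
      unit X ≫ (StrictNCat.forget n).map G = ψ →
      (StrictNCat.Hom.map G).app k q' = val (k := k.unop) q D ψ := by
    rintro D ψ G rfl
    exact Option.some.inj ((eval_hom (unit X) G _ _ hq').symm.trans (eval_term ..))
  have hq : q' = q := Free.ext fun D ψ => key D ψ (desc D ψ) (unit_desc D ψ)
  subst hq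
  exact key C φ F hF

end Free

/-- The forgetful functor from strict `n`-categories to `n`-globular sets has a left adjoint. -/
instance (n : ℕ∞) : (StrictNCat.forget.{u} n).IsRightAdjoint :=
  haveI : ∀ X : NGlob.{u} n, HasInitial (StructuredArrow X (StrictNCat.forget.{u} n)) :=
    fun X => IsInitial.hasInitial (X := StructuredArrow.mk (S := X) (T := StrictNCat.forget.{u} n)
      (Y := Free.strictNCat X) (Free.unit X)) <|
      IsInitial.ofUniqueHom
        (fun Y => StructuredArrow.homMk (Free.desc Y.right Y.hom) (Free.unit_desc _ _))
        (fun Y m => by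
          ext1
          exact Free.desc_unique _ (StructuredArrow.w m))
  isRightAdjointOfStructuredArrowInitials _

/-! ### `n`-operads -/

/-- The strict `n`-category monad `𝒯_{≤n}` on `n`-globular sets: the monad of the adjunction
between the free strict `n`-category functor and the forgetful functor. -/
noncomputable def strictNCatMonad (n : ℕ∞) : Monad (NGlob.{u} n) :=
  (Adjunction.ofIsRightAdjoint (StrictNCat.forget.{u} n)).toMonad

/-- An `n`-operad: a monad `A` on `n`-globular sets with a cartesian monad morphism to the strict
`n`-category monad, i.e. a monad morphism all of whose naturality squares are pullbacks. Its
algebras are the algebras of the monad `A`. -/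
structure NOperad (n : ℕ∞) where
  monad : Monad (NGlob.{u} n)
  toStrict : monad ⟶ strictNCatMonad.{u} n
  cartesian : NatTrans.Equifibered (MonadHom.toNatTrans toStrict)

end Glob

/-! The heart of (1) is a recognition criterion: a cocomplete category with a small strong generator
of connected `κ`-presentable objects is locally `κ`-c-presentable
(`isLocallyCPresentable_of_isStrongGenerator`). Closing the generator under `κ`-small connected
colimits keeps it essentially small, connected and presentable, and makes its comma category over
any `X` `κ`-c-filtered. A `κ`-c-filtered category is a disjoint union of `κ`-filtered ones, so a map
from a connected presentable object into a `κ`-c-filtered colimit factors through a stage; this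
identifies the canonical colimit with `X`. Free algebras on a generator of `V` satisfy the
criterion, since the forgetful functor of `T` inherits preservation of colimits from `T`.

The cocompleteness of `T.Algebra` needs a separate argument (`hasColimits_algebra`). The nerve on
free algebras over `κ`-presentable objects identifies algebras with the presheaves orthogonal to a
small set of maps between presentable presheaves, and such presheaves form a reflective subcategory.

For (2), presheaf categories satisfy the criterion through representables. The operations of a
strict `n`-category are defined on cells and on composable pairs, that is, on fibre products, and
these commute with c-filtered colimits of sets. So the forgetful functor, hence the strict
`n`-category monad, preserves c-filtered colimits (`StrictNCat.preservesColimitsOfShape_forget`). A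
cartesian monad morphism transfers this to every `n`-operad
(`preservesColimitsOfShape_of_equifibered`). Filtered and discrete categories are both c-filtered,
so (1) applies. -/

namespace CPres

/-! ### c-filtered categories and their connected components -/

section CFiltered

variable {J : Type u} [Category.{v} J] (κ : Cardinal.{w}) [hκ : Fact κ.IsRegular]

lemma IsCardinalCFiltered.cocone_nonempty [IsCardinalCFiltered J κ] {A : Type*} [Category A]
    [CategoryTheory.IsConnected A] (F : A ⥤ J) (hA : HasCardinalLT (Arrow A) κ) :
    Nonempty (Cocone F) := by
  have := hA.small
  have := small_of_small_arrow.{w} A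
  have := locallySmall_of_small_arrow.{w} A
  let e := (Shrink.equivalence.{w} A).trans (ShrinkHoms.equivalence.{w} (Shrink.{w} A))
  have := isConnected_of_equivalent e
  exact ⟨(Cocone.equivalenceOfReindexing e.symm (Iso.refl _)).inverse.obj
    (nonempty_cocone (κ := κ) (e.inverse ⋙ F) (by simpa)).some⟩

lemma IsCardinalCFiltered.of_equivalence {J' : Type*} [Category J'] [IsCardinalCFiltered J κ]
    (e : J ≌ J') : IsCardinalCFiltered J' κ where
  nonempty_cocone F hA :=
    ⟨e.inverse.mapCoconeInv (IsCardinalCFiltered.cocone_nonempty κ (F ⋙ e.inverse) hA).some⟩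

lemma IsCardinalCFiltered.wideSpan [IsCardinalCFiltered J κ] {ι : Type w} {j : J} {k : ι → J}
    (f : ∀ i, j ⟶ k i) (hι : HasCardinalLT ι κ) :
    ∃ (m : J) (a : ∀ i, k i ⟶ m) (b : j ⟶ m), ∀ i, f i ≫ a i = b := by
  have h : HasCardinalLT (Arrow (WidePushoutShape ι)) κ := by
    -- The identity at the centre is listed twice; only surjectivity matters.
    let φ : Option (Option ι) ⊕ ι → Arrow (WidePushoutShape ι) := fun x => match x with
      | .inl none => Arrow.mk (𝟙 (show WidePushoutShape ι from none))
      | .inl (some a) => Arrow.mk (𝟙 (show WidePushoutShape ι from a))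
      | .inr i => Arrow.mk (WidePushoutShape.Hom.init i)
    have hκ' := hκ.out.aleph0_le
    refine HasCardinalLT.of_surjective (X := Option (Option ι) ⊕ ι) ?_ φ ?_
    · rw [hasCardinalLT_sum_iff _ _ _ hκ', hasCardinalLT_option_iff _ _ hκ',
        hasCardinalLT_option_iff _ _ hκ']
      exact ⟨hι, hι⟩
    · rintro ⟨a, b, (_ | i)⟩
      · rcases a with _ | i
        · exact ⟨.inl none, rfl⟩
        · exact ⟨.inl (some (some i)), rfl⟩
      · exact ⟨.inr i, rfl⟩
  obtain ⟨c⟩ := IsCardinalCFiltered.cocone_nonempty κ (WidePushoutShape.wideSpan j k f) h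
  exact ⟨c.pt, fun i => c.ι.app (some i), c.ι.app none, fun i => c.w (WidePushoutShape.Hom.init i)⟩

instance (T : Type*) [Nonempty T] : IsConnected (WalkingParallelFamily T) := by
  have : Nonempty (WalkingParallelFamily T) := ⟨.zero⟩
  refine IsConnected.of_induct (j₀ := .zero) fun p h0 h j => ?_
  rcases j with _ | _
  · exact h0
  · exact (h (WalkingParallelFamily.Hom.line (Classical.arbitrary T))).1 h0

lemma IsCardinalCFiltered.coeq [IsCardinalCFiltered J κ] {ι : Type w} [Nonempty ι] {j k : J}
    (f : ι → (j ⟶ k)) (hι : HasCardinalLT ι κ) :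
    ∃ (l : J) (a : k ⟶ l) (b : j ⟶ l), ∀ i, f i ≫ a = b := by
  obtain ⟨c⟩ := IsCardinalCFiltered.cocone_nonempty κ (parallelFamily f)
    (hasCardinalLT_arrow_walkingParallelFamily hι hκ.out.aleph0_le)
  exact ⟨c.pt, c.ι.app .one, c.ι.app .zero, fun i => c.w (.line i)⟩

lemma IsCardinalCFiltered.span [IsCardinalCFiltered J κ] {j k₁ k₂ : J} (f₁ : j ⟶ k₁)
    (f₂ : j ⟶ k₂) : ∃ (m : J) (a₁ : k₁ ⟶ m) (a₂ : k₂ ⟶ m), f₁ ≫ a₁ = f₂ ≫ a₂ := by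
  obtain ⟨m, a, b, h⟩ := IsCardinalCFiltered.wideSpan κ (ι := ULift Bool) (j := j)
    (k := fun i => if i.down then k₁ else k₂)
    (fun i => match i with
      | ⟨true⟩ => f₁
      | ⟨false⟩ => f₂)
    (hasCardinalLT_of_finite _ _ hκ.out.aleph0_le)
  exact ⟨m, a ⟨true⟩, a ⟨false⟩, (h ⟨true⟩).trans (h ⟨false⟩).symm⟩

/-- Spans complete to commutative squares, so a zigzag collapses to a single cospan by induction on
its length. -/
lemma IsCardinalCFiltered.exists_of_zigzag [IsCardinalCFiltered J κ] {i j : J} (h : Zigzag i j) :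
    ∃ k, Nonempty (i ⟶ k) ∧ Nonempty (j ⟶ k) := by
  induction h with
  | refl => exact ⟨i, ⟨𝟙 _⟩, ⟨𝟙 _⟩⟩
  | tail _ h ih =>
    obtain ⟨k, ⟨a⟩, ⟨b⟩⟩ := ih
    rcases h with ⟨⟨f⟩⟩ | ⟨⟨f⟩⟩
    · obtain ⟨m, a₁, a₂, _⟩ := IsCardinalCFiltered.span κ b f
      exact ⟨m, ⟨a ≫ a₁⟩, ⟨a₂⟩⟩
    · exact ⟨k, ⟨a⟩, ⟨f ≫ b⟩⟩

lemma mem_component_of_hom {c : CategoryTheory.ConnectedComponents J} {j k : J} (f : j ⟶ k)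
    (hj : c.objectProperty j) : c.objectProperty k := by
  rw [← show Quotient.mk'' j = c from hj]
  exact Quotient.sound' (Zigzag.of_inv f)

/-- Upper bounds are found by joining every object to a fixed `j₀` by a cospan and amalgamating the
legs out of `j₀`, which form a connected diagram. -/
instance [IsCardinalCFiltered J κ] (c : CategoryTheory.ConnectedComponents J) :
    IsCardinalFiltered c.Component κ := by
  rw [isCardinalFiltered_iff]
  constructor
  · intro ι j hι
    let j₀ : c.Component := default
    have h (i : ι) : ∃ k, Nonempty (j₀.obj ⟶ k) ∧ Nonempty ((j i).obj ⟶ k) :=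
      IsCardinalCFiltered.exists_of_zigzag κ
        (Quotient.exact' (j₀.property.trans (j i).property.symm))
    choose k f g using h
    obtain ⟨m, a, b, _⟩ := IsCardinalCFiltered.wideSpan κ (fun i => (f i).some) hι
    exact ⟨⟨m, mem_component_of_hom b j₀.property⟩,
      fun i => ⟨ObjectProperty.homMk ((g i).some ≫ a i)⟩⟩
  · intro ι j k f hι
    obtain ⟨m, e₁, e₂⟩ : ∃ (m : c.Component), Nonempty (j ⟶ m) ∧ Nonempty (k ⟶ m) := by
      obtain ⟨m, ⟨a⟩, ⟨b⟩⟩ := IsCardinalCFiltered.exists_of_zigzag κ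
        (Quotient.exact' (j.property.trans k.property.symm) : Zigzag j.obj k.obj)
      exact ⟨⟨m, mem_component_of_hom a j.property⟩, ⟨ObjectProperty.homMk a⟩,
        ⟨ObjectProperty.homMk b⟩⟩
    -- The shape of an empty parallel family is disconnected, so c-filteredness says nothing about
    -- it; the upper bound `m` serves instead.
    rcases isEmpty_or_nonempty ι with _ | _
    · exact ⟨m, e₂.some, e₁.some, fun i => isEmptyElim i⟩
    · obtain ⟨l, a, b, h⟩ := IsCardinalCFiltered.coeq κ (fun i => (f i).hom) hι
      exact ⟨⟨l, mem_component_of_hom b j.property⟩, ObjectProperty.homMk a,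
        ObjectProperty.homMk b, fun i => by ext; exact h i⟩

end CFiltered

/-! ### Colimits computed over connected components -/

section Colimits

variable {J : Type*} [Category J] {C : Type*} [Category C]

/-- The coproduct of the colimits of a functor over the connected components of its domain is a
cocone over the functor. -/
@[simps]
def coconeOfComponents {D : J ⥤ C}
    (s : ∀ c : CategoryTheory.ConnectedComponents J, Cocone (c.ι ⋙ D))
    (t : Cofan fun c => (s c).pt) : Cocone D where
  pt := t.pt
  ι :=
    { app := fun j => (s (.mk j)).ι.app ⟨j, rfl⟩ ≫ t.inj (.mk j)
      naturality := fun j k f => by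
        -- The components of `j` and `k` are only propositionally equal; a variable `c` lets the
        -- equality be eliminated by substitution.
        have key (c : CategoryTheory.ConnectedComponents J) (hk : c.objectProperty k) :
            (s (.mk k)).ι.app ⟨k, rfl⟩ ≫ t.inj (.mk k) = (s c).ι.app ⟨k, hk⟩ ≫ t.inj c := by
          obtain rfl : .mk k = c := hk
          rfl
        rw [key (.mk j) (mem_component_of_hom f rfl)]
        let f' : (⟨j, rfl⟩ : (CategoryTheory.ConnectedComponents.mk j).Component) ⟶
            ⟨k, mem_component_of_hom f rfl⟩ := ObjectProperty.homMk f
        have := (s (.mk j)).w f'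
        dsimp [f'] at this ⊢
        rw [reassoc_of% this, Category.comp_id] }

lemma coconeOfComponents_ι {D : J ⥤ C}
    (s : ∀ c : CategoryTheory.ConnectedComponents J, Cocone (c.ι ⋙ D))
    (t : Cofan fun c => (s c).pt) (c : CategoryTheory.ConnectedComponents J) (j : c.Component) :
    (coconeOfComponents s t).ι.app j.obj = (s c).ι.app j ≫ t.inj c := by
  obtain ⟨j, rfl⟩ := j
  rfl

/-- The cocone given by colimits over connected components is a colimit. -/
def isColimitCoconeOfComponents {D : J ⥤ C}
    (s : ∀ c : CategoryTheory.ConnectedComponents J, Cocone (c.ι ⋙ D))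
    (t : Cofan fun c => (s c).pt) (hs : ∀ c, IsColimit (s c)) (ht : IsColimit t) :
    IsColimit (coconeOfComponents s t) where
  desc r := Cofan.IsColimit.desc ht fun c => (hs c).desc (r.whisker c.ι)
  fac r j := by
    refine (Category.assoc _ _ _).trans (Eq.trans ?_ ((hs (.mk j)).fac (r.whisker _) ⟨j, rfl⟩))
    exact congr((s (.mk j)).ι.app ⟨j, rfl⟩ ≫ $(Cofan.IsColimit.fac ht
      (fun c => (hs c).desc (r.whisker c.ι)) (.mk j)))
  uniq r m hm := by
    refine Cofan.IsColimit.hom_ext ht _ _ fun c => (hs c).hom_ext fun j => ?_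
    have h := hm j.obj
    rw [coconeOfComponents_ι] at h
    refine ((Category.assoc _ _ _).symm.trans h).trans ?_
    simp

end Colimits

/-! ### Connected objects and the recognition criterion -/

section Connected

variable {V : Type u} [Category.{w} V]

lemma isConnectedObject_iff (C : V) : IsConnectedObject C ↔
    ∀ ⦃ι : Type w⦄ ⦃X : ι → V⦄ (t : Cofan X), IsColimit t →
      Function.Bijective (fun f : Σ i, (C ⟶ X i) => f.2 ≫ t.inj f.1) := by
  have key {ι : Type w} {X : ι → V} (t : Cofan X) :
      Nonempty (IsColimit ((coyoneda.obj (op C)).mapCocone t)) ↔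
        Function.Bijective (fun f : Σ i, (C ⟶ X i) => f.2 ≫ t.inj f.1) := by
    rw [(Cofan.isColimitMapCoconeEquiv (coyoneda.obj (op C)) X t).nonempty_congr]
    exact Cofan.nonempty_isColimit_iff_bijective_fromSigma
      (Cofan.mk (f := fun i => (coyoneda.obj (op C)).obj (X i)) _
        fun i => (coyoneda.obj (op C)).map (t.inj i))
  constructor
  · intro h ι X t ht
    have := h ι
    exact (key t).1 ⟨isColimitOfPreserves _ ht⟩
  · intro h ι
    refine ⟨fun {K} => ?_⟩
    have : PreservesColimit (Discrete.functor (K.obj ∘ Discrete.mk)) (coyoneda.obj (op C)) :=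
      ⟨fun {t} ht => (key t).2 (h t ht)⟩
    exact preservesColimit_of_iso_diagram _ Discrete.natIsoFunctor.symm

/-- A map out of the colimit is a compatible family of maps, each landing in one summand. The index
of that summand is invariant along arrows, hence constant on the connected shape. -/
lemma isConnectedObject_of_isColimit {A : Type*} [Category A] [CategoryTheory.IsConnected A]
    {F : A ⥤ V}
    {c : Cocone F} (hc : IsColimit c) (hF : ∀ a, IsConnectedObject (F.obj a)) :
    IsConnectedObject c.pt := by
  rw [isConnectedObject_iff]
  intro ι X t ht
  have hF' a := (isConnectedObject_iff _).1 (hF a) t ht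
  constructor
  · rintro ⟨i, f⟩ ⟨j, g⟩ h
    have e (a : A) : (⟨i, c.ι.app a ≫ f⟩ : Σ i, (F.obj a ⟶ X i)) = ⟨j, c.ι.app a ≫ g⟩ :=
      (hF' a).1 (by simpa using congr(c.ι.app a ≫ $h))
    obtain rfl : i = j := congr_arg Sigma.fst (e (Classical.arbitrary A))
    obtain rfl : f = g := hc.hom_ext fun a => by simpa using e a
    rfl
  · intro f
    let a₀ : A := Classical.arbitrary A
    choose x hx using fun a => (hF' a).2 (c.ι.app a ≫ f)
    have hx' {a b : A} (φ : a ⟶ b) : x a = ⟨(x b).1, F.map φ ≫ (x b).2⟩ :=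
      (hF' a).1 (by simp [hx])
    obtain ⟨i, hi⟩ : ∃ i, ∀ a, ∃ g : F.obj a ⟶ X i, g ≫ t.inj i = c.ι.app a ≫ f := by
      refine ⟨(x a₀).1, fun a => ?_⟩
      rw [← constant_of_preserves_morphisms (fun a => (x a).1)
        (fun a b φ => congr_arg Sigma.fst (hx' φ)) a a₀]
      exact ⟨_, hx a⟩
    choose g hg using hi
    refine ⟨⟨i, hc.desc (Cocone.mk _ { app := g, naturality := fun a b φ => ?_ })⟩,
      hc.hom_ext fun a => ?_⟩
    · have : (⟨i, F.map φ ≫ g b⟩ : Σ i, (F.obj a ⟶ X i)) = ⟨i, g a⟩ := (hF' a).1 (by simp [hg])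
      simpa using this
    · simp [hg]

variable (κ : Cardinal.{w})

/-- The colimit is a coproduct of `κ`-filtered colimits, one for each component of `J`.
Connectedness of `C` selects the component, presentability the stage in it. -/
lemma exists_fac_of_isCardinalCFiltered [Fact κ.IsRegular] [HasColimitsOfSize.{w, w} V] {C : V}
    (hC : IsConnectedObject C) [IsCardinalPresentable C κ] {J : Type*} [Category J]
    [EssentiallySmall.{w} J] [IsCardinalCFiltered J κ] {D : J ⥤ V} {s : Cocone D}
    (hs : IsColimit s) (f : C ⟶ s.pt) : ∃ (j : J) (g : C ⟶ D.obj j), g ≫ s.ι.app j = f := by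
  let e := equivSmallModel.{w} J
  have := IsCardinalCFiltered.of_equivalence κ e
  let D' := e.inverse ⋙ D
  let s' (c : CategoryTheory.ConnectedComponents (SmallModel.{w} J)) := colimit.cocone (c.ι ⋙ D')
  let t := colimit.cocone (Discrete.functor fun c => (s' c).pt)
  let hr : IsColimit (s.whisker e.inverse) := hs.whiskerEquivalence e.symm
  let hr' := isColimitCoconeOfComponents s' t (fun c => colimit.isColimit _) (colimit.isColimit _)
  obtain ⟨⟨c, g⟩, hg⟩ := ((isConnectedObject_iff C).1 hC t (colimit.isColimit _)).2
    (f ≫ (hr.coconePointUniqueUpToIso hr').hom)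
  obtain ⟨j, g', hg'⟩ := IsCardinalPresentable.exists_hom_of_isColimit κ (colimit.isColimit _) g
  refine ⟨e.inverse.obj j.obj, g', ?_⟩
  refine (cancel_mono (hr.coconePointUniqueUpToIso hr').hom).1 (Eq.trans ?_ hg)
  have := hr.comp_coconePointUniqueUpToIso_hom hr' j.obj
  rw [coconeOfComponents_ι] at this
  dsimp only at this ⊢
  rw [← hg', Category.assoc, Category.assoc]
  exact congr(g' ≫ $this)

/-- The closure of a property of objects under colimits of connected diagrams with fewer than `κ`
arrows. -/
def connectedColimitsClosure (P : ObjectProperty V) : ObjectProperty V :=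
  P.colimitsClosure (fun A : { A : SmallCategoryCardinalLT κ //
    IsConnected (SmallCategoryCardinalLT.categoryFamily κ A) } =>
      SmallCategoryCardinalLT.categoryFamily κ A.1)

lemma isClosedUnderColimitsOfShape_connectedColimitsClosure (P : ObjectProperty V)
    (A : Type*) [Category A] [CategoryTheory.IsConnected A] (hA : HasCardinalLT (Arrow A) κ) :
    (connectedColimitsClosure κ P).IsClosedUnderColimitsOfShape A := by
  obtain ⟨S, ⟨e⟩⟩ := SmallCategoryCardinalLT.exists_equivalence κ A hA
  have := isConnected_of_equivalent e.symm
  rw [← ObjectProperty.isClosedUnderColimitsOfShape_iff_of_equivalence _ e]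
  exact ObjectProperty.instIsClosedUnderColimitsOfShapeColimitsClosure P
    (fun A : { A : SmallCategoryCardinalLT κ //
      IsConnected (SmallCategoryCardinalLT.categoryFamily κ A) } =>
        SmallCategoryCardinalLT.categoryFamily κ A.1) ⟨S, this⟩

instance (P : ObjectProperty V) [ObjectProperty.EssentiallySmall.{w} P] :
    ObjectProperty.EssentiallySmall.{w} (connectedColimitsClosure κ P) := by
  dsimp [connectedColimitsClosure]
  infer_instance

instance (P : ObjectProperty V) :
    (connectedColimitsClosure κ P).IsClosedUnderIsomorphisms := by
  dsimp [connectedColimitsClosure]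
  infer_instance

lemma le_connectedColimitsClosure (P : ObjectProperty V) : P ≤ connectedColimitsClosure κ P :=
  P.le_colimitsClosure _

variable [Fact κ.IsRegular]

/-- Connectedness survives because the shapes are connected, presentability because they are
`κ`-small. -/
lemma connectedColimitsClosure_le {P : ObjectProperty V}
    (hP : ∀ X, P X → IsConnectedObject X ∧ IsCardinalPresentable X κ) :
    ∀ X, connectedColimitsClosure κ P X → IsConnectedObject X ∧ IsCardinalPresentable X κ := by
  intro X hX
  induction hX with
  | of_mem X hX => exact hP X hX
  | of_isoClosure e _ h =>
    refine ⟨?_, have := h.2; isCardinalPresentable_of_iso e κ⟩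
    exact fun ι => have := h.1 ι; preservesColimitsOfShape_of_natIso (coyoneda.mapIso e.symm.op)
  | @of_colimitPresentation X A p _ h =>
    have := A.2
    exact ⟨isConnectedObject_of_isColimit p.isColimit fun a => (h a).1,
      have (a : SmallCategoryCardinalLT.categoryFamily κ A.1) :
        IsCardinalPresentable (p.diag.obj a) κ := (h a).2
      isCardinalPresentable_of_isColimit _ p.isColimit κ A.1.hasCardinalLT⟩

/-- The closure property gives the comma category all `κ`-small connected colimits, and a colimit
cocone is in particular a cocone. -/
instance (P : ObjectProperty V) [HasColimitsOfSize.{w, w} V] (X : V) :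
    IsCardinalCFiltered (CostructuredArrow (connectedColimitsClosure κ P).ι X) κ where
  nonempty_cocone {A} _ _ K hA := ⟨by
    have := isClosedUnderColimitsOfShape_connectedColimitsClosure κ P A hA
    exact colimit.cocone K⟩

/-- A cocomplete category with a small strong generator consisting of connected
`κ`-presentable objects is locally `κ`-c-presentable. -/
theorem isLocallyCPresentable_of_isStrongGenerator [HasColimitsOfSize.{w, w} V]
    {P : ObjectProperty V} [ObjectProperty.EssentiallySmall.{w} P] (hP : P.IsStrongGenerator)
    (hP' : ∀ X, P X → IsConnectedObject X ∧ IsCardinalPresentable X κ) :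
    IsLocallyCPresentable V κ where
  cocomplete := inferInstance
  exists_generator := by
    obtain ⟨Q, _, h₁, h₂⟩ :=
      ObjectProperty.EssentiallySmall.exists_small_le.{w} (connectedColimitsClosure κ P)
    refine ⟨Q, inferInstance, fun X hX => connectedColimitsClosure_le κ hP' X (h₁ X hX),
      fun X => ?_⟩
    let ι := (connectedColimitsClosure κ P).ι
    let e := equivSmallModel.{w} (CostructuredArrow ι X)
    refine ⟨SmallModel.{w} (CostructuredArrow ι X), inferInstance,
      IsCardinalCFiltered.of_equivalence κ e, ?_⟩
    -- `Q` meets every isomorphism class of the closure, so diagrams in the closure can be replaced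
    -- by diagrams in `Q`.
    suffices h : (connectedColimitsClosure κ P).colimitsOfShape
        (SmallModel.{w} (CostructuredArrow ι X)) X by
      have := ObjectProperty.colimitsOfShape_monotone
        (SmallModel.{w} (CostructuredArrow ι X)) h₂ _ h
      rwa [ObjectProperty.colimitsOfShape_isoClosure] at this
    let Φ := CostructuredArrow.proj ι X ⋙ ι
    have : HasColimitsOfShape (CostructuredArrow ι X) V := hasColimitsOfShape_of_equivalence e.symm
    let c : Cocone Φ := Cocone.mk X
      { app := fun j => j.hom
        naturality := fun i j f => (CostructuredArrow.w f).trans (Category.comp_id _).symm }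
    let obj {G : V} (hG : P G) (f : G ⟶ X) : CostructuredArrow ι X :=
      CostructuredArrow.mk (Y := ⟨G, le_connectedColimitsClosure κ P _ hG⟩) (by exact f)
    -- A map from a generator to the colimit is the coprojection indexed by its own image in `X`. It
    -- is therefore determined by that image, which makes the comparison map to `X` a monomorphism.
    have fac {G : V} (hG : P G) (g : G ⟶ colimit Φ) :
        g = colimit.ι Φ (obj hG (g ≫ colimit.desc Φ c)) := by
      have := (hP' G hG).2
      obtain ⟨j, g, rfl⟩ :=
        exists_fac_of_isCardinalCFiltered κ (hP' G hG).1 (colimit.isColimit Φ) g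
      have h : (g ≫ colimit.ι Φ j) ≫ colimit.desc Φ c = g ≫ j.hom := by simp [c]
      let ψ : obj hG ((g ≫ colimit.ι Φ j) ≫ colimit.desc Φ c) ⟶ j :=
        CostructuredArrow.homMk (ObjectProperty.homMk g) h.symm
      exact colimit.w Φ ψ
    have : Mono (colimit.desc Φ c) := by
      rw [hP.isSeparating.mono_iff]
      intro G hG g₁ g₂ h
      rw [fac hG g₁, fac hG g₂, h]
    have : IsIso (colimit.desc Φ c) := hP.isIso_of_mono _ fun G hG g =>
      ⟨colimit.ι Φ (obj hG g), colimit.ι_desc c _⟩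
    let hc : IsColimit c := IsColimit.ofIsoColimit (colimit.isColimit Φ)
      (Cocone.ext (asIso (colimit.desc Φ c)))
    exact ⟨{ diag := _
             ι := _
             isColimit := hc.whiskerEquivalence e.symm
             prop_diag_obj := fun j => (e.inverse.obj j).left.property }⟩

end Connected

/-! ### Density: testing and defining maps on canonical colimits -/

section Dense

variable {K : Type*} [Category K] {V : Type*} [Category V] (i : K ⥤ V) [i.IsDense]
  {W : Type*} [Category W] (G : V ⥤ W)

/-- The canonical cocone under the diagram of all morphisms from objects `i.obj k` to `X`. -/
@[simps]
def canonicalCocone (X : V) : Cocone (CostructuredArrow.proj i X ⋙ i) where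
  pt := X
  ι :=
    { app := fun j => j.hom
      naturality := fun _ _ f => (CostructuredArrow.w f).trans (Category.comp_id _).symm }

/-- If `i` is dense, the canonical cocone is a colimit. -/
noncomputable def isColimitCanonicalCocone (X : V) : IsColimit (canonicalCocone i X) :=
  IsColimit.ofIsoColimit (i.denseAt X) (Cocone.ext (Iso.refl _) fun _ =>
    (Category.comp_id _).trans (Category.id_comp _))

/-- Meant for `G` the identity, `T` and `T ⋙ T`: equations between maps out of `X`, `TX` and `TTX`
reduce to maps from the objects `i.obj k`. -/
lemma hom_ext_of_isDense {X : V} [PreservesColimitsOfShape (CostructuredArrow i X) G] {Y : W}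
    {f g : G.obj X ⟶ Y} (h : ∀ (k : K) (x : i.obj k ⟶ X), G.map x ≫ f = G.map x ≫ g) : f = g :=
  (isColimitOfPreserves G (isColimitCanonicalCocone i X)).hom_ext fun j => h _ j.hom

lemma exists_desc_of_isDense {X : V} [PreservesColimitsOfShape (CostructuredArrow i X) G] {Y : W}
    (φ : ∀ k : K, (i.obj k ⟶ X) → (G.obj (i.obj k) ⟶ Y))
    (hφ : ∀ {k l : K} (g : k ⟶ l) (x : i.obj l ⟶ X),
      φ k (i.map g ≫ x) = G.map (i.map g) ≫ φ l x) :
    ∃ f : G.obj X ⟶ Y, ∀ (k : K) (x : i.obj k ⟶ X), G.map x ≫ f = φ k x := by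
  let s : Cocone ((CostructuredArrow.proj i X ⋙ i) ⋙ G) := Cocone.mk Y
    { app := fun j => φ _ j.hom
      naturality := fun j j' f => by
        have := hφ f.left j'.hom
        rw [CostructuredArrow.w f] at this
        exact this.symm.trans (Category.comp_id _).symm }
  exact ⟨(isColimitOfPreserves G (isColimitCanonicalCocone i X)).desc s, fun k x =>
    (isColimitOfPreserves G (isColimitCanonicalCocone i X)).fac s (CostructuredArrow.mk x)⟩

end Dense

/-! ### The nerve of algebras on free algebras -/

section Kleisli

variable {K : Type w} [SmallCategory K] {V : Type u} [Category.{w} V]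

/-- The category of free algebras on the objects `i.obj k`. -/
structure FreeAlg (_T : Monad V) (_i : K ⥤ V) where
  /-- the index of the generating object -/
  of : K

namespace FreeAlg

variable {T : Monad V} {i : K ⥤ V}

/-- Morphisms of free algebras, as Kleisli morphisms. -/
@[ext]
structure Hom (k l : FreeAlg T i) where
  /-- the restriction to generators -/
  hom : i.obj k.of ⟶ T.obj (i.obj l.of)

instance : Category (FreeAlg T i) where
  Hom := Hom
  id k := ⟨T.η.app _⟩
  comp f g := ⟨f.hom ≫ T.map g.hom ≫ T.μ.app _⟩
  id_comp f := by
    apply Hom.ext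
    dsimp
    rw [← T.unit_naturality_assoc, T.left_unit]
    exact Category.comp_id _
  comp_id f := by
    ext
    simp
  assoc f g h := by
    apply Hom.ext
    simp [T.assoc, T.mu_naturality_assoc]

/-- The morphism of free algebras given by a Kleisli morphism. -/
def lift {k l : K} (f : i.obj k ⟶ T.obj (i.obj l)) : (⟨k⟩ : FreeAlg T i) ⟶ ⟨l⟩ := ⟨f⟩

lemma lift_comp {k l m : K} (f : i.obj k ⟶ T.obj (i.obj l)) (g : i.obj l ⟶ T.obj (i.obj m)) :
    lift f ≫ lift g = lift (f ≫ T.map g ≫ T.μ.app _) := rfl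

lemma lift_unit (k : K) : lift (T.η.app (i.obj k)) = 𝟙 (⟨k⟩ : FreeAlg T i) := rfl

lemma incl_map_lift {k l m : K} (g : k ⟶ l) (f : i.obj l ⟶ T.obj (i.obj m)) :
    lift (i.map g ≫ T.η.app _) ≫ lift f = lift (i.map g ≫ f) := by
  rw [lift_comp, Category.assoc, ← T.unit_naturality_assoc, T.left_unit]
  exact congrArg (fun a => lift (i.map g ≫ a)) (Category.comp_id f)

lemma lift_incl_map {k l m : K} (f : i.obj k ⟶ T.obj (i.obj l)) (g : l ⟶ m) :
    lift f ≫ lift (i.map g ≫ T.η.app _) = lift (f ≫ T.map (i.map g)) := by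
  simp [lift_comp]

variable (T i)

/-- The free algebra functor. -/
@[simps]
def incl : K ⥤ FreeAlg T i where
  obj k := ⟨k⟩
  map f := lift (i.map f ≫ T.η.app _)
  map_id k := by simp [lift_unit]
  map_comp f g := by rw [incl_map_lift, i.map_comp, Category.assoc]

variable {T i}

lemma unit_map_act {A : T.Algebra} {X : V} (x : X ⟶ A.A) : T.η.app X ≫ T.map x ≫ A.a = x := by
  have := Monad.unit_naturality (T := T) (f := x)
  rw [← Category.assoc, ← this, Category.assoc, A.unit]
  exact Category.comp_id x

variable (T i)

/-- The nerve functor from algebras to presheaves on the category of free algebras. -/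
@[simps]
def nerve : T.Algebra ⥤ ((FreeAlg T i)ᵒᵖ ⥤ Type w) where
  obj A :=
    { obj := fun k => i.obj k.unop.of ⟶ A.A
      map := fun f => TypeCat.ofHom fun x => f.unop.hom ≫ T.map x ≫ A.a
      map_id := fun k => by
        ext x
        exact unit_map_act x
      map_comp := fun {k l m} f g => by
        ext x
        change (g.unop.hom ≫ T.map f.unop.hom ≫ T.μ.app _) ≫ T.map x ≫ A.a =
          g.unop.hom ≫ T.map (f.unop.hom ≫ T.map x ≫ A.a) ≫ A.a
        simp [← A.assoc, T.mu_naturality_assoc] }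
  map φ :=
    { app := fun k => TypeCat.ofHom fun x => x ≫ φ.f
      naturality := fun k l f => by
        ext x
        simp }

section

variable [i.IsDense] [∀ X, PreservesColimitsOfShape (CostructuredArrow i X) T.toFunctor]

instance : (nerve T i).Faithful where
  map_injective {A B} f g h := by
    ext1
    exact hom_ext_of_isDense i (𝟭 V) fun k x => congr(($h).app (op ⟨k⟩) x)

/-- Naturality along maps of `K` and density of `i` give the underlying map `f`. Naturality along
the remaining Kleisli maps says that `f` commutes with the actions. -/
instance : (nerve T i).Full where
  map_surjective {A B} α := by
    let φ (k : K) (x : i.obj k ⟶ A.A) : i.obj k ⟶ B.A := α.app (op ⟨k⟩) x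
    have hφ' {k l : K} (f : i.obj k ⟶ T.obj (i.obj l)) (x : i.obj l ⟶ A.A) :
        φ k (f ≫ T.map x ≫ A.a) = f ≫ T.map (φ l x) ≫ B.a :=
      NatTrans.naturality_apply α (lift f).op x
    have hφ {k l : K} (g : k ⟶ l) (x : i.obj l ⟶ A.A) :
        φ k (i.map g ≫ x) = i.map g ≫ φ l x := by
      have := hφ' (i.map g ≫ T.η.app _) x
      rwa [Category.assoc, Category.assoc, unit_map_act, unit_map_act] at this
    obtain ⟨f, hf⟩ := exists_desc_of_isDense i (𝟭 V) (X := A.A) φ hφ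
    dsimp at hf
    refine ⟨{ f := f, h := ?_ }, ?_⟩
    · refine hom_ext_of_isDense i T.toFunctor fun l x => ?_
      refine hom_ext_of_isDense i (𝟭 V) fun k g => ?_
      dsimp
      rw [← T.map_comp_assoc, hf, ← hφ', ← hf]
      simp
    · ext k x
      exact hf _ x

end

-- If the restriction of `P` to `K` is given by maps into `X`, the action of Kleisli morphisms on
-- `P` supplies the missing algebra structure on `X`.
variable {T i} in
lemma exists_nerve_iso [i.IsDense]
    [∀ X, PreservesColimitsOfShape (CostructuredArrow i X) T.toFunctor]
    [∀ X, PreservesColimitsOfShape (CostructuredArrow i X) (T.toFunctor ⋙ T.toFunctor)]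
    (P : (FreeAlg T i)ᵒᵖ ⥤ Type w) (X : V) (e : ∀ k : K, P.obj (op ⟨k⟩) ≃ (i.obj k ⟶ X))
    (he : ∀ {k l : K} (g : k ⟶ l) (x : P.obj (op ⟨l⟩)),
      e k (P.map (lift (i.map g ≫ T.η.app _)).op x) = i.map g ≫ e l x) :
    ∃ A : T.Algebra, Nonempty ((nerve T i).obj A ≅ P) := by
  have map_lift {k l m : K} (f : i.obj k ⟶ T.obj (i.obj l)) (g : i.obj l ⟶ T.obj (i.obj m))
      (x : P.obj (op ⟨m⟩)) :
      P.map (lift f).op (P.map (lift g).op x) = P.map (lift f ≫ lift g).op x := by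
    simp
  -- `m l x` is to be the composite of `T.map x` with the structure map; its values on maps from
  -- `i.obj k` are dictated by `P`.
  have hm (l : K) (x : i.obj l ⟶ X) : ∃ m : T.obj (i.obj l) ⟶ X,
      ∀ (k : K) (f : i.obj k ⟶ T.obj (i.obj l)),
        f ≫ m = e k (P.map (lift f).op ((e l).symm x)) := by
    refine exists_desc_of_isDense i (𝟭 V)
      (fun k f => e k (P.map (lift f).op ((e l).symm x))) fun g f => ?_
    rw [← incl_map_lift, ← map_lift, he]
    rfl
  choose m hm using hm
  -- The maps `m l x` glue because `T` preserves the canonical colimit of `X`.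
  obtain ⟨a, ha⟩ := exists_desc_of_isDense i T.toFunctor (X := X) m fun {k l} g x => by
    refine hom_ext_of_isDense i (𝟭 V) fun j f => ?_
    have : (e k).symm (i.map g ≫ x) = P.map (lift (i.map g ≫ T.η.app _)).op ((e l).symm x) :=
      (Equiv.symm_apply_eq _).2 (by rw [he, Equiv.apply_symm_apply])
    dsimp at f ⊢
    rw [hm, ← Category.assoc, hm, this, map_lift, lift_incl_map]
  let A : T.Algebra :=
    { A := X
      a := a
      unit := by
        refine hom_ext_of_isDense i (𝟭 V) fun k x => ?_
        dsimp
        rw [T.unit_naturality_assoc, ha, hm, lift_unit]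
        simp
      assoc := by
        -- Tested on three layers of generators, associativity becomes functoriality of `P` on a
        -- composite of two Kleisli maps.
        refine hom_ext_of_isDense i (T.toFunctor ⋙ T.toFunctor) fun l x => ?_
        refine hom_ext_of_isDense i T.toFunctor fun k f => ?_
        refine hom_ext_of_isDense i (𝟭 V) fun j g => ?_
        dsimp at f g ⊢
        rw [T.mu_naturality_assoc, ha, ← T.map_comp_assoc (T.map x), ha, ← T.map_comp_assoc f,
          ha, hm, hm, Equiv.symm_apply_apply, map_lift, lift_comp, ← hm]
        simp }
  refine ⟨A, ⟨NatIso.ofComponents (fun k => (e k.unop.of).symm.toIso) fun {l k} f => ?_⟩⟩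
  ext x
  change i.obj l.unop.of ⟶ X at x
  change (e k.unop.of).symm (f.unop.hom ≫ T.map x ≫ a) = P.map f ((e l.unop.of).symm x)
  rw [ha, hm, Equiv.symm_apply_apply]
  rfl

end FreeAlg

end Kleisli
-- Orthogonality to comparison maps of small colimits
section

variable {κ : Cardinal.{w}} [Fact κ.IsRegular] {K : Type w} [SmallCategory K] {V : Type u}
  [Category.{w} V] (i : K ⥤ V) [i.Full] [i.Faithful] {E : Type v} [Category.{w} E] (H : K ⥤ E)

/-- `X` is the colimit of `i` over the elements of `P`. Since `i.obj k` is presentable and the index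
category filtered, a map into `X` comes from a stage, and full faithfulness of `i` turns it into an
element of `P`. Two elements identified in `X` are restrictions of one element along the same map,
so they are equal. -/
lemma exists_equiv_of_isCardinalFiltered (hi : ∀ k, IsCardinalPresentable (i.obj k) κ)
    (P : E) [IsCardinalFiltered (CostructuredArrow H P) κ]
    [HasColimit (CostructuredArrow.proj H P ⋙ i)] :
    ∃ (X : V) (e : ∀ k, (H.obj k ⟶ P) ≃ (i.obj k ⟶ X)), ∀ {k l : K} (g : k ⟶ l)
      (x : H.obj l ⟶ P), e k (H.map g ≫ x) = i.map g ≫ e l x := by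
  let F := CostructuredArrow.proj H P ⋙ i
  let φ (k : K) (x : H.obj k ⟶ P) : i.obj k ⟶ colimit F := colimit.ι F (CostructuredArrow.mk x)
  have hφ {k l : K} (g : k ⟶ l) (x : H.obj l ⟶ P) : φ k (H.map g ≫ x) = i.map g ≫ φ l x :=
    (colimit.w F (CostructuredArrow.homMk g :
      CostructuredArrow.mk (H.map g ≫ x) ⟶ CostructuredArrow.mk x)).symm
  refine ⟨colimit F, fun k => Equiv.ofBijective (φ k) ⟨fun x y h => ?_, fun f => ?_⟩, hφ⟩
  · have : IsCardinalPresentable (i.obj k) κ := hi k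
    obtain ⟨j, a, b, hab⟩ := IsCardinalPresentable.exists_eq_of_isColimit κ (colimit.isColimit F)
      (i₁ := CostructuredArrow.mk x) (i₂ := CostructuredArrow.mk y) (𝟙 (i.obj k)) (𝟙 (i.obj k))
      ((Category.id_comp _).trans (h.trans (Category.id_comp _).symm))
    have hab' : a.left = b.left := i.map_injective
      ((Category.id_comp _).symm.trans (hab.trans (Category.id_comp _)))
    have ha := CostructuredArrow.w a
    have hb := CostructuredArrow.w b
    rw [hab'] at ha
    exact ha.symm.trans hb
  · have : IsCardinalPresentable (i.obj k) κ := hi k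
    obtain ⟨j, f', hf'⟩ := IsCardinalPresentable.exists_hom_of_isColimit κ (colimit.isColimit F) f
    obtain ⟨g, rfl⟩ := i.map_surjective f'
    exact ⟨H.map g ≫ j.hom, (hφ g j.hom).trans hf'⟩

-- A small diagram of elements of `P` has a cocone in `K` that `i` sends to a colimit; the gluing
-- hypothesis on `P` extends the elements to its vertex.
omit [i.Full] [i.Faithful] in
lemma isCardinalFiltered_costructuredArrow
    (hi : ∀ (S : SmallCategoryCardinalLT κ) (D : SmallCategoryCardinalLT.categoryFamily κ S ⥤ K),
      ∃ c : Cocone D, Nonempty (IsColimit (i.mapCocone c))) (P : E)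
    (hP : ∀ (S : SmallCategoryCardinalLT κ) (D : SmallCategoryCardinalLT.categoryFamily κ S ⥤ K)
      (c : Cocone D), IsColimit (i.mapCocone c) → ∀ s : D ⋙ H ⟶ (Functor.const _).obj P,
      ∃ y : H.obj c.pt ⟶ P, ∀ a, H.map (c.ι.app a) ≫ y = s.app a) :
    IsCardinalFiltered (CostructuredArrow H P) κ where
  nonempty_cocone {A _} F hA := by
    obtain ⟨S, ⟨e⟩⟩ := SmallCategoryCardinalLT.exists_equivalence κ A hA
    let G := e.functor ⋙ F
    obtain ⟨c, ⟨hc⟩⟩ := hi S (G ⋙ CostructuredArrow.proj H P)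
    obtain ⟨y, hy⟩ := hP S _ c hc
      { app := fun a => (G.obj a).hom
        naturality := fun a b f =>
          (CostructuredArrow.w (G.map f)).trans (Category.comp_id _).symm }
    let d : Cocone G :=
      { pt := CostructuredArrow.mk y
        ι :=
          { app := fun a => CostructuredArrow.homMk (c.ι.app a) (hy a)
            naturality := fun a b f => by
              ext
              exact c.ι.naturality f } }
    exact ⟨(Cocone.precompose (e.invFunIdAssoc F).inv).obj (d.whisker e.inverse)⟩

end

section

variable (κ : Cardinal.{w}) [Fact κ.IsRegular] {K : Type w} [SmallCategory K] {V : Type u}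
  [Category.{w} V] (i : K ⥤ V)

/-- The index type of `κ`-small diagrams in `K` with a cocone that `i` maps to a colimit. -/
structure SmallColimitCocone where
  /-- the shape -/
  shape : SmallCategoryCardinalLT κ
  /-- the diagram -/
  diag : SmallCategoryCardinalLT.categoryFamily κ shape ⥤ K
  /-- the cocone -/
  cocone : Cocone diag
  isColimit : Nonempty (IsColimit (i.mapCocone cocone))

variable {E : Type v} [Category.{w} E] [HasColimitsOfSize.{w, w} E] (H : K ⥤ E)

/-- The comparison morphisms `colim (H D) ⟶ H (colim D)`. -/
noncomputable def comparisons : MorphismProperty E :=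
  MorphismProperty.ofHoms fun s : SmallColimitCocone κ i =>
    colimit.desc (s.diag ⋙ H) (H.mapCocone s.cocone)

instance : MorphismProperty.IsSmall.{w} (comparisons κ i H) := by
  unfold comparisons
  infer_instance

omit [Fact κ.IsRegular] in
lemma isLocal_comparisons_iff (P : E) : (comparisons κ i H).isLocal P ↔
    ∀ (s : SmallColimitCocone κ i) (t : s.diag ⋙ H ⟶ (Functor.const _).obj P),
      ∃! y : H.obj s.cocone.pt ⟶ P, ∀ a, H.map (s.cocone.ι.app a) ≫ y = t.app a := by
  have key (s : SmallColimitCocone κ i) (t : s.diag ⋙ H ⟶ (Functor.const _).obj P)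
      (y : H.obj s.cocone.pt ⟶ P) :
      colimit.desc (s.diag ⋙ H) (H.mapCocone s.cocone) ≫ y = colimit.desc _ (Cocone.mk P t) ↔
        ∀ a, H.map (s.cocone.ι.app a) ≫ y = t.app a := by
    refine ⟨fun h a => ?_, fun h => colimit.hom_ext fun a => ?_⟩
    · simpa using colimit.ι (s.diag ⋙ H) a ≫= h
    · simpa using h a
  refine ⟨fun h s t => ?_, fun h => ?_⟩
  · simp only [← key]
    exact (h _ (MorphismProperty.ofHoms.mk s)).existsUnique _
  · rintro _ _ _ ⟨s⟩
    rw [Function.bijective_iff_existsUnique]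
    intro b
    have := h s ((colimit.cocone _).ι ≫ (Functor.const _).map b)
    simp only [← key] at this
    convert! this using 3
    exact colimit.hom_ext fun a => by simp

lemma isCardinalPresentable_of_comparisons (hH : ∀ k, IsCardinalPresentable (H.obj k) κ)
    ⦃X Y : E⦄ (f : X ⟶ Y) (hf : comparisons κ i H f) :
    IsCardinalPresentable X κ ∧ IsCardinalPresentable Y κ := by
  obtain ⟨s⟩ := hf
  have (a : SmallCategoryCardinalLT.categoryFamily κ s.shape) :
      IsCardinalPresentable ((s.diag ⋙ H).obj a) κ := hH _
  exact ⟨isCardinalPresentable_of_isColimit _ (colimit.isColimit (s.diag ⋙ H)) κ s.shape.2, hH _⟩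

/-- Objects local for a small set of maps between `κ`-presentable objects form a reflective
subcategory, which inherits colimits. -/
lemma hasColimits_isLocal_comparisons (hH : ∀ k, IsCardinalPresentable (H.obj k) κ) :
    HasColimitsOfSize.{w, w} (comparisons κ i H).isLocal.FullSubcategory := by
  have := MorphismProperty.isRightAdjoint_ι_isLocal (comparisons κ i H) κ
    (isCardinalPresentable_of_comparisons κ i H hH)
  let : Reflective (comparisons κ i H).isLocal.ι :=
    { L := _
      adj := Adjunction.ofIsRightAdjoint _ }
  exact ⟨fun J _ => hasColimitsOfShape_of_reflective (comparisons κ i H).isLocal.ι⟩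

end

/-! ### The image of the nerve, and cocompleteness of algebras -/

namespace FreeAlg

variable (κ : Cardinal.{w}) [Fact κ.IsRegular] {K : Type w} [SmallCategory K] {V : Type u}
  [Category.{w} V] {T : Monad V} {i : K ⥤ V}

/-- Sections of the nerve. -/
def nerveEquiv (A : T.Algebra) (k : K) :
    ((incl T i ⋙ yoneda).obj k ⟶ (nerve T i).obj A) ≃ (i.obj k ⟶ A.A) :=
  yonedaEquiv

lemma nerveEquiv_comp {A : T.Algebra} {k l : K} (g : k ⟶ l)
    (x : (incl T i ⋙ yoneda).obj l ⟶ (nerve T i).obj A) :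
    nerveEquiv A k ((incl T i ⋙ yoneda).map g ≫ x) = i.map g ≫ nerveEquiv A l x := by
  refine (yonedaEquiv_naturality x ((incl T i).map g)).symm.trans ?_
  refine (Category.assoc _ _ _).trans ?_
  exact congrArg (i.map g ≫ ·) (unit_map_act (A := A) (nerveEquiv A l x))

-- By Yoneda the orthogonality condition concerns maps `i.obj k ⟶ A.A`, where it is the universal
-- property of the colimits in `V`.
omit [Fact κ.IsRegular] in
lemma isLocal_nerve_obj (A : T.Algebra) :
    (comparisons κ i (incl T i ⋙ yoneda)).isLocal ((nerve T i).obj A) := by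
  rw [isLocal_comparisons_iff]
  intro s t
  have hs := s.isColimit.some
  let d : Cocone (s.diag ⋙ i) := Cocone.mk A.A
    { app := fun a => nerveEquiv (i := i) A (s.diag.obj a) (t.app a)
      naturality := fun a b f => by
        have := t.naturality f
        dsimp only [Functor.const_obj_map, Functor.const_obj_obj, Functor.comp_map] at this ⊢
        rw [Category.comp_id, ← nerveEquiv_comp]
        exact congrArg _ (this.trans (Category.comp_id _)) }
  refine ⟨(nerveEquiv A _).symm (hs.desc d), fun a => ?_, fun y hy => ?_⟩
  · apply (nerveEquiv A _).injective
    refine (nerveEquiv_comp _ _).trans ?_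
    exact (congrArg (_ ≫ ·) (Equiv.apply_symm_apply _ _)).trans (hs.fac d a)
  · rw [Equiv.eq_symm_apply]
    refine hs.uniq d _ fun a => ?_
    exact (nerveEquiv_comp _ y).symm.trans (congrArg _ (hy a))

lemma isCardinalPresentable_yoneda_obj {C : Type w} [SmallCategory C] (X : C) :
    IsCardinalPresentable (yoneda.obj X) κ := by
  let e : coyoneda.obj (op (yoneda.obj X)) ≅ (evaluation Cᵒᵖ (Type w)).obj (op X) :=
    NatIso.ofComponents fun P => Equiv.toIso yonedaEquiv
  exact ⟨fun J _ _ => preservesColimitsOfShape_of_natIso e.symm⟩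

-- Presentable objects are closed under `κ`-small colimits, so by `hi'` these can be formed in `K`.
-- Locality then makes the category of elements of `P` over `K` `κ`-filtered; its colimit in `V`
-- carries the desired algebra.
variable {κ} in
lemma mem_essImage_nerve_of_isLocal [i.Full] [i.Faithful] [i.IsDense]
    [HasColimitsOfSize.{w, w} V]
    [∀ X, PreservesColimitsOfShape (CostructuredArrow i X) T.toFunctor]
    [∀ X, PreservesColimitsOfShape (CostructuredArrow i X) (T.toFunctor ⋙ T.toFunctor)]
    (hi : ∀ k, IsCardinalPresentable (i.obj k) κ)
    (hi' : ∀ X, IsCardinalPresentable X κ → i.essImage X)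
    {P : (FreeAlg T i)ᵒᵖ ⥤ Type w} (hP : (comparisons κ i (incl T i ⋙ yoneda)).isLocal P) :
    (nerve T i).essImage P := by
  rw [isLocal_comparisons_iff] at hP
  have := isCardinalFiltered_costructuredArrow (κ := κ) i (incl T i ⋙ yoneda) (fun S D => by
    have (a : SmallCategoryCardinalLT.categoryFamily κ S) :
      IsCardinalPresentable ((D ⋙ i).obj a) κ := hi _
    obtain ⟨k, ⟨e⟩⟩ := hi' _
      (isCardinalPresentable_of_isColimit _ (colimit.isColimit (D ⋙ i)) κ S.2)
    let c : Cocone D :=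
      { pt := k
        ι :=
          { app := fun a => i.preimage (colimit.ι (D ⋙ i) a ≫ e.inv)
            naturality := fun a b f => i.map_injective (by
              simpa using colimit.w_assoc (D ⋙ i) f e.inv) } }
    exact ⟨c, ⟨IsColimit.ofIsoColimit (colimit.isColimit (D ⋙ i)) (Cocone.ext e.symm (fun a => by
      simp [c]))⟩⟩) P
    (fun S D c hc s => (hP ⟨S, D, c, ⟨hc⟩⟩ s).exists)
  obtain ⟨X, e, he⟩ := exists_equiv_of_isCardinalFiltered (κ := κ) i (incl T i ⋙ yoneda) hi P
  obtain ⟨A, hA⟩ := exists_nerve_iso P X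
    (fun k => (yonedaEquiv (X := (⟨k⟩ : FreeAlg T i))).symm.trans (e k)) fun {k l} g x => by
      refine Eq.trans ?_ (he g (yonedaEquiv.symm x))
      refine congrArg (e k) ?_
      refine (Equiv.symm_apply_eq _).2 ?_
      refine Eq.trans ?_ (yonedaEquiv_naturality (yonedaEquiv.symm x) ((incl T i).map g))
      exact congrArg _ (Equiv.apply_symm_apply _ _).symm
  exact ⟨A, hA⟩

lemma hasColimits_algebra_of_isDense [i.Full] [i.Faithful] [i.IsDense]
    [HasColimitsOfSize.{w, w} V]
    [∀ X, PreservesColimitsOfShape (CostructuredArrow i X) T.toFunctor]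
    [∀ X, PreservesColimitsOfShape (CostructuredArrow i X) (T.toFunctor ⋙ T.toFunctor)]
    (hi : ∀ k, IsCardinalPresentable (i.obj k) κ)
    (hi' : ∀ X, IsCardinalPresentable X κ → i.essImage X) :
    HasColimitsOfSize.{w, w} T.Algebra := by
  have := hasColimits_isLocal_comparisons κ i (incl T i ⋙ yoneda)
    (fun k => isCardinalPresentable_yoneda_obj κ _)
  let N := (comparisons κ i (incl T i ⋙ yoneda)).isLocal.lift (nerve T i) (isLocal_nerve_obj κ)
  have : N.EssSurj := ⟨fun P => by
    obtain ⟨A, ⟨e⟩⟩ := mem_essImage_nerve_of_isLocal hi hi' P.2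
    exact ⟨A, ⟨(ObjectProperty.fullyFaithfulι _).preimageIso e⟩⟩⟩
  have : N.IsEquivalence := { }
  exact ⟨fun J _ => Adjunction.hasColimitsOfShape_of_equivalence N⟩

end FreeAlg

/-- The Eilenberg–Moore category of an accessible monad on a locally presentable category is
cocomplete. -/
theorem hasColimits_algebra (κ : Cardinal.{w}) [Fact κ.IsRegular] {V : Type u} [Category.{w} V]
    [IsCardinalLocallyPresentable V κ] (T : Monad V) [T.toFunctor.IsCardinalAccessible κ] :
    HasColimitsOfSize.{w, w} T.Algebra := by
  let e := equivSmallModel.{w} (isCardinalPresentable V κ).FullSubcategory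
  let i := e.inverse ⋙ (isCardinalPresentable V κ).ι
  have (X : V) : EssentiallySmall.{w} (CostructuredArrow i X) := essentiallySmallSelf _
  -- Filteredness of the canonical diagrams is what lets the accessible functors `T` and `T ⋙ T`
  -- preserve their colimits.
  have (X : V) : IsCardinalFiltered (CostructuredArrow i X) κ :=
    IsCardinalFiltered.of_equivalence κ
      (CostructuredArrow.pre e.inverse (isCardinalPresentable V κ).ι X).asEquivalence.symm
  have (X : V) := T.preservesColimitsOfShape_of_isCardinalAccessible_of_essentiallySmall κ
    (CostructuredArrow i X)
  have : HasColimitsOfSize.{w, w} V := inferInstance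
  exact FreeAlg.hasColimits_algebra_of_isDense κ (i := i) (fun k => (e.inverse.obj k).2)
    fun X hX => ⟨e.functor.obj ⟨X, hX⟩,
      ⟨(isCardinalPresentable V κ).ι.mapIso (e.unitIso.app ⟨X, hX⟩).symm⟩⟩

/-! ### Free algebras on a generator, and part (1) -/

section

variable {V : Type u} [Category.{w} V]

lemma IsConnectedObject.of_iso {X Y : V} (hX : IsConnectedObject X) (e : X ≅ Y) :
    IsConnectedObject Y := fun ι =>
  have := hX ι
  preservesColimitsOfShape_of_natIso (coyoneda.mapIso e.symm.op)

variable (T : Monad V)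

lemma preservesColimitsOfShape_forget (J : Type*) [Category J] [HasColimitsOfShape J V]
    [PreservesColimitsOfShape J T.toFunctor] : PreservesColimitsOfShape J T.forget :=
  inferInstance

/-- By adjunction, maps out of the free algebra are maps from `X` into the underlying object, and
the forgetful functor preserves coproducts because `T` does. -/
lemma isConnectedObject_free [HasColimitsOfSize.{w, w} V]
    (hT : PreservesSmallCoproducts T.toFunctor) {X : V} (hX : IsConnectedObject X) :
    IsConnectedObject (T.free.obj X) := fun ι => by
  have := hX ι
  have := hT ι
  let e : coyoneda.obj (op (T.free.obj X)) ≅ T.forget ⋙ coyoneda.obj (op X) :=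
    NatIso.ofComponents (fun A => (T.adj.homEquiv X A).toIso) fun f => by
      ext x
      exact T.adj.homEquiv_naturality_right x f
  exact preservesColimitsOfShape_of_natIso e.symm

lemma isCardinalPresentable_free (κ : Cardinal.{w}) [Fact κ.IsRegular]
    [HasColimitsOfSize.{w, w} V] [T.toFunctor.IsCardinalAccessible κ] (X : V)
    [IsCardinalPresentable X κ] : IsCardinalPresentable (T.free.obj X) κ := by
  have : T.forget.IsCardinalAccessible κ := ⟨fun J _ _ => by
    have := T.preservesColimitsOfShape_of_isCardinalAccessible κ J
    exact preservesColimitsOfShape_forget T J⟩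
  exact T.adj.isCardinalPresentable_leftAdjoint_obj κ X

/-- Both conditions transpose across the adjunction, the forgetful functor being faithful and
conservative. -/
lemma isStrongGenerator_map_free {P : ObjectProperty V} (hP : P.IsStrongGenerator) :
    (P.map T.free).IsStrongGenerator := by
  rw [ObjectProperty.isStrongGenerator_iff] at hP ⊢
  refine ⟨fun A B f g h => ?_, fun A B f _ hf => ?_⟩
  · refine T.forget.map_injective (hP.1 _ _ fun G hG x => ?_)
    have := h (T.free.obj G) (P.prop_map_obj T.free hG) ((T.adj.homEquiv G A).symm x)
    rw [← T.adj.homEquiv_naturality_right_symm, ← T.adj.homEquiv_naturality_right_symm] at this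
    exact (T.adj.homEquiv G B).symm.injective this
  · have : IsIso (T.forget.map f) := hP.2 _ fun G hG x => by
      obtain ⟨y, hy⟩ := hf (T.free.obj G) (P.prop_map_obj T.free hG)
        ((T.adj.homEquiv G B).symm x)
      refine ⟨T.adj.homEquiv G A y, ?_⟩
      dsimp only at hy ⊢
      rw [← T.adj.homEquiv_naturality_right, hy, Equiv.apply_symm_apply]
    exact isIso_of_reflects_iso f T.forget

end

/-- The algebras of a monad preserving `κ`-filtered colimits and small coproducts on a locally
`κ`-c-presentable category form a locally `κ`-c-presentable category. -/
theorem isLocallyCPresentable_algebra (κ : Cardinal.{w}) [Fact κ.IsRegular] {V : Type u}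
    [Category.{w} V] [IsLocallyCPresentable V κ] (T : Monad V)
    [T.toFunctor.IsCardinalAccessible κ] (hT : PreservesSmallCoproducts T.toFunctor) :
    IsLocallyCPresentable T.Algebra κ := by
  have : HasColimitsOfSize.{w, w} V := IsLocallyCPresentable.cocomplete κ
  obtain ⟨S, _, hS, hS'⟩ := IsLocallyCPresentable.exists_generator (V := V) (κ := κ)
  have hS'' : S.IsStrongGenerator := .mk_of_exists_colimitsOfShape fun X => by
    obtain ⟨J, _, _, hJ⟩ := hS' X
    exact ⟨J, _, hJ⟩
  -- Needed only for the cocompleteness of the category of algebras.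
  have : IsCardinalLocallyPresentable V κ := by
    rw [IsCardinalLocallyPresentable.iff_exists_isStrongGenerator]
    exact ⟨S, inferInstance, hS'', fun X hX => (hS X hX).2⟩
  have := hasColimits_algebra κ T
  refine isLocallyCPresentable_of_isStrongGenerator κ (isStrongGenerator_map_free T hS'') ?_
  rintro A ⟨X, hX, ⟨e⟩⟩
  have := (hS X hX).2
  have := isCardinalPresentable_free T κ X
  exact ⟨(isConnectedObject_free T hT (hS X hX).1).of_iso e, isCardinalPresentable_of_iso e κ⟩

/-! ### c-filtered colimits of sets -/

section Types

variable (κ : Cardinal.{w}) [Fact κ.IsRegular] {J : Type w} [SmallCategory J]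
  [IsCardinalCFiltered J κ]

include κ in
lemma IsCardinalCFiltered.exists_comp_eq {i j : J} (f g : i ⟶ j) :
    ∃ (k : J) (h : j ⟶ k), f ≫ h = g ≫ h := by
  obtain ⟨k, h, b, hb⟩ := IsCardinalCFiltered.coeq κ (ι := ULift.{w} Bool)
    (fun a => if a.down then f else g)
    (hasCardinalLT_of_finite _ _ (Cardinal.IsRegular.aleph0_le Fact.out))
  exact ⟨k, h, (hb ⟨true⟩).trans (hb ⟨false⟩).symm⟩

variable {F : J ⥤ Type w} {c : Cocone F}

include κ in
/-- Elements with the same image in a c-filtered colimit of types agree at a later stage. -/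
lemma exists_map_eq_map_of_isColimit (hc : IsColimit c) {i j : J} {x : F.obj i} {y : F.obj j}
    (h : c.ι.app i x = c.ι.app j y) :
    ∃ (k : J) (f : i ⟶ k) (g : j ⟶ k), F.map f x = F.map g y := by
  have h' : colimit.ι F i x = colimit.ι F j y := by
    have key (i : J) (x : F.obj i) : colimit.ι F i x = hc.desc (colimit.cocone F) (c.ι.app i x) :=
      congr($((hc.fac (colimit.cocone F) i).symm) x)
    rw [key, key, h]
  have hgen := Types.colimit_eq h'
  suffices ∀ (p q : Σ j, F.obj j), Relation.EqvGen F.ColimitTypeRel p q →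
      ∃ (k : J) (f : p.1 ⟶ k) (g : q.1 ⟶ k), F.map f p.2 = F.map g q.2 from this _ _ hgen
  intro p q hpq
  induction hpq with
  | rel p q h =>
    obtain ⟨f, hf⟩ := h
    exact ⟨q.1, f, 𝟙 _, by simp [hf]⟩
  | refl p => exact ⟨p.1, 𝟙 _, 𝟙 _, rfl⟩
  | symm p q _ ih =>
    obtain ⟨k, f, g, h⟩ := ih
    exact ⟨k, g, f, h.symm⟩
  | trans p q r _ _ ih₁ ih₂ =>
    obtain ⟨k₁, f₁, g₁, h₁⟩ := ih₁
    obtain ⟨k₂, f₂, g₂, h₂⟩ := ih₂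
    -- The two maps to be amalgamated both start at the index of the middle element `q`, so the lack
    -- of upper bounds for arbitrary pairs does no harm.
    obtain ⟨k, a₁, a₂, ha⟩ := IsCardinalCFiltered.span κ g₁ f₂
    refine ⟨k, f₁ ≫ a₁, g₂ ≫ a₂, ?_⟩
    simp only [Functor.map_comp, ConcreteCategory.comp_apply, h₁, ← h₂]
    simp only [← ConcreteCategory.comp_apply, ← Functor.map_comp, ha]

include κ in
/-- Elements at the same stage with the same image in a c-filtered colimit of types agree at a
later stage. -/
lemma exists_map_eq_of_isColimit (hc : IsColimit c) {i : J} {x y : F.obj i}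
    (h : c.ι.app i x = c.ι.app i y) : ∃ (k : J) (f : i ⟶ k), F.map f x = F.map f y := by
  obtain ⟨k, f, g, hfg⟩ := exists_map_eq_map_of_isColimit κ hc h
  obtain ⟨l, a, ha⟩ := IsCardinalCFiltered.exists_comp_eq κ f g
  refine ⟨l, f ≫ a, ?_⟩
  conv_rhs => rw [ha]
  simp only [Functor.map_comp, ConcreteCategory.comp_apply, hfg]

omit [IsCardinalCFiltered J κ] [Fact κ.IsRegular] in
/-- A criterion for a cocone of types to be a colimit. -/
lemma nonempty_isColimit_of_exists_map_eq_map
    (h₁ : ∀ x : c.pt, ∃ (j : J) (y : F.obj j), c.ι.app j y = x)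
    (h₂ : ∀ {i j : J} (x : F.obj i) (y : F.obj j), c.ι.app i x = c.ι.app j y →
      ∃ (k : J) (f : i ⟶ k) (g : j ⟶ k), F.map f x = F.map g y) : Nonempty (IsColimit c) := by
  have key : Function.Bijective (colimit.desc F c) := by
    have fac (j : J) (x : F.obj j) : colimit.desc F c (colimit.ι F j x) = c.ι.app j x :=
      congr($(colimit.ι_desc c j) x)
    refine ⟨fun x y h => ?_, fun x => ?_⟩
    · obtain ⟨i, x, rfl⟩ := Types.jointly_surjective' x
      obtain ⟨j, y, rfl⟩ := Types.jointly_surjective' y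
      rw [fac, fac] at h
      obtain ⟨k, f, g, hfg⟩ := h₂ x y h
      exact Types.colimit_sound' f g hfg
    · obtain ⟨j, y, rfl⟩ := h₁ x
      exact ⟨colimit.ι F j y, fac j y⟩
  have : IsIso (colimit.desc F c) := (isIso_iff_bijective _).2 key
  exact ⟨IsColimit.ofIsoColimit (colimit.isColimit F)
    (Cocone.ext (asIso (colimit.desc F c)) fun j => colimit.ι_desc c j)⟩

end Types

/-- A functor from a connected category to a discrete one is constant. This lets results on
c-filtered colimits cover coproducts. -/
instance isCardinalCFiltered_discrete (κ : Cardinal.{w}) [Fact κ.IsRegular] (ι : Type*) :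
    IsCardinalCFiltered (Discrete ι) κ where
  nonempty_cocone {A _ _} F _ :=
    ⟨{ pt := F.obj (Classical.arbitrary A)
       ι := (isoConstant F (Classical.arbitrary A)).hom }⟩

lemma isCardinalCFiltered_of_isCardinalFiltered (J : Type*) [Category J] (κ : Cardinal.{w})
    [Fact κ.IsRegular] [IsCardinalFiltered J κ] : IsCardinalCFiltered J κ where
  nonempty_cocone F hA := IsCardinalFiltered.nonempty_cocone F hA

/-! ### Transfer along cartesian transformations -/

section Equifibered

variable (κ : Cardinal.{w}) [Fact κ.IsRegular] {J : Type w} [SmallCategory J]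
  [IsCardinalCFiltered J κ] {D : Type u} [Category.{v} D] {C : Type*} [Category C]

include κ in
/-- Preservation of c-filtered colimits lifts along equifibered transformations of functors to
presheaves. -/
lemma preservesColimitsOfShape_of_equifibered {G H : C ⥤ Dᵒᵖ ⥤ Type w} (α : G ⟶ H)
    (hα : NatTrans.Equifibered α) [PreservesColimitsOfShape J H] :
    PreservesColimitsOfShape J G := by
  refine ⟨fun {F} => ⟨fun {c} hc => ⟨evaluationJointlyReflectsColimits _ fun d => ?_⟩⟩⟩
  have hH := isColimitOfPreserves ((evaluation _ _).obj d) (isColimitOfPreserves H hc)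
  have sq {X Y : C} (f : X ⟶ Y) : IsPullback ((G.map f).app d) ((α.app X).app d)
      ((α.app Y).app d) ((H.map f).app d) :=
    (hα f).map ((evaluation _ _).obj d)
  have nat {X Y : C} (f : X ⟶ Y) (x : (G.obj X).obj d) :
      (α.app Y).app d ((G.map f).app d x) = (H.map f).app d ((α.app X).app d x) :=
    congr($((sq f).w) x)
  refine (nonempty_isColimit_of_exists_map_eq_map (fun x => ?_) fun {i j} x y h => ?_).some
  · obtain ⟨j, y, hy⟩ := Types.jointly_surjective_of_isColimit hH ((α.app _).app d x)
    obtain ⟨z, hz, _⟩ := Types.exists_of_isPullback (sq (c.ι.app j)) x y hy.symm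
    exact ⟨j, z, hz⟩
  · have h' : (H.map (c.ι.app i)).app d ((α.app _).app d x) =
        (H.map (c.ι.app j)).app d ((α.app _).app d y) := by
      rw [← nat, ← nat]
      exact congrArg _ h
    -- At stage `k` the two elements agree in `H`, and they agree in the cocone point for `G`; by
    -- the pullback square they are equal.
    obtain ⟨k, f, g, hfg⟩ := exists_map_eq_map_of_isColimit κ hH h'
    refine ⟨k, f, g, Types.ext_of_isPullback (sq (c.ι.app k)) ?_ ?_⟩
    · have w {i j : J} (f : i ⟶ j) (x : (G.obj (F.obj i)).obj d) :
          (G.map (c.ι.app j)).app d ((G.map (F.map f)).app d x) =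
            (G.map (c.ι.app i)).app d x := by
        rw [← NatTrans.comp_app_apply, ← G.map_comp, c.w]
      exact (w f x).trans (h.trans (w g y).symm)
    · exact (nat _ x).trans (hfg.trans (nat _ y).symm)

end Equifibered

end CPres

/-! ### c-filtered colimits of strict n-categories -/

namespace Glob

open CPres

variable {n : ℕ∞}

section Globular

variable (X : NGlob.{u} n) {k l m : Globe n} (h : k.dim < l.dim) (h' : l.dim < m.dim)
  (x : X.cell m)

lemma NGlob.src_src : X.src h (X.src h' x) = X.src (h.trans h') x :=
  congr($(X.map_comp (srcIncl h').op (srcIncl h).op) x).symm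

lemma NGlob.src_tgt : X.src h (X.tgt h' x) = X.src (h.trans h') x :=
  congr($(X.map_comp (tgtIncl h').op (srcIncl h).op) x).symm

lemma NGlob.tgt_src : X.tgt h (X.src h' x) = X.tgt (h.trans h') x :=
  congr($(X.map_comp (srcIncl h').op (tgtIncl h).op) x).symm

lemma NGlob.tgt_tgt : X.tgt h (X.tgt h' x) = X.tgt (h.trans h') x :=
  congr($(X.map_comp (tgtIncl h').op (tgtIncl h).op) x).symm

/-- Of the four composability conditions in the interchange law, the last follows from the other
three. -/
lemma NGlob.tgt_eq_src_of_tgt_eq_src {x y x' y' : X.cell m} (e₁ : X.tgt h' x = X.src h' y)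
    (e₂ : X.tgt h' x' = X.src h' y') (e₃ : X.tgt (h.trans h') x = X.src (h.trans h') x') :
    X.tgt (h.trans h') y = X.src (h.trans h') y' := by
  rw [← X.tgt_src h h', ← X.src_src h h', ← e₁, ← e₂, X.tgt_tgt, X.src_tgt, e₃]

end Globular

namespace StrictNCat

lemma comp_congr (C : StrictNCat.{u} n) {k l : Globe n} (h : k.dim < l.dim)
    {x x' y y' : C.cells.cell l} (e : C.cells.tgt h x = C.cells.src h y)
    (e' : C.cells.tgt h x' = C.cells.src h y') (hx : x = x') (hy : y = y') :
    C.comp h x y e = C.comp h x' y' e' := by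
  subst hx hy
  rfl

section Colimit

variable (κ : Cardinal.{w}) [Fact κ.IsRegular] {J : Type w} [SmallCategory J]
  [IsCardinalCFiltered J κ] {F : J ⥤ StrictNCat.{w} n} (c : Cocone (F ⋙ forget n))

/-- The maps of cells in the diagram. -/
def tr (F : J ⥤ StrictNCat.{w} n) {i j : J} (f : i ⟶ j) {k : Globe n}
    (x : (F.obj i).cells.cell k) : (F.obj j).cells.cell k :=
  (StrictNCat.Hom.map (F.map f)).app (op k) x

/-- The maps of cells to the cocone point. -/
def inc (j : J) {k : Globe n} (x : (F.obj j).cells.cell k) : NGlob.cell c.pt k :=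
  NatTrans.app (show (F.obj j).cells ⟶ c.pt from c.ι.app j) (op k) x

lemma tr_src {i j : J} (f : i ⟶ j) {k l : Globe n} (h : k.dim < l.dim)
    (x : (F.obj i).cells.cell l) :
    (F.obj j).cells.src h (tr F f x) = tr F f ((F.obj i).cells.src h x) :=
  (NGlob.map_src _ h x).symm

lemma tr_tgt {i j : J} (f : i ⟶ j) {k l : Globe n} (h : k.dim < l.dim)
    (x : (F.obj i).cells.cell l) :
    (F.obj j).cells.tgt h (tr F f x) = tr F f ((F.obj i).cells.tgt h x) :=
  (NGlob.map_tgt _ h x).symm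

lemma tr_composable {i j : J} (f : i ⟶ j) {k l : Globe n} (h : k.dim < l.dim)
    {x y : (F.obj i).cells.cell l} (e : (F.obj i).cells.tgt h x = (F.obj i).cells.src h y) :
    (F.obj j).cells.tgt h (tr F f x) = (F.obj j).cells.src h (tr F f y) :=
  NGlob.map_composable _ h e

lemma tr_ident {i j : J} (f : i ⟶ j) {k l : Globe n} (h : k.dim < l.dim)
    (x : (F.obj i).cells.cell k) :
    tr F f ((F.obj i).ident h x) = (F.obj j).ident h (tr F f x) :=
  StrictNCat.Hom.map_ident _ h x

lemma tr_comp {i j : J} (f : i ⟶ j) {k l : Globe n} (h : k.dim < l.dim)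
    (x y : (F.obj i).cells.cell l) (e : (F.obj i).cells.tgt h x = (F.obj i).cells.src h y) :
    tr F f ((F.obj i).comp h x y e) =
      (F.obj j).comp h (tr F f x) (tr F f y) (tr_composable f h e) :=
  StrictNCat.Hom.map_comp _ h x y e _

variable {c}

lemma inc_tr {i j : J} (f : i ⟶ j) {k : Globe n} (x : (F.obj i).cells.cell k) :
    inc c j (tr F f x) = inc c i x :=
  congr(NatTrans.app $(c.w f) (op k) x)

lemma src_inc (j : J) {k l : Globe n} (h : k.dim < l.dim) (x : (F.obj j).cells.cell l) :
    NGlob.src c.pt h (inc c j x) = inc c j ((F.obj j).cells.src h x) :=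
  (NGlob.map_src (X := (F.obj j).cells) (c.ι.app j) h x).symm

lemma tgt_inc (j : J) {k l : Globe n} (h : k.dim < l.dim) (x : (F.obj j).cells.cell l) :
    NGlob.tgt c.pt h (inc c j x) = inc c j ((F.obj j).cells.tgt h x) :=
  (NGlob.map_tgt (X := (F.obj j).cells) (c.ι.app j) h x).symm

section

variable (hc : IsColimit c)

include hc

lemma exists_inc_eq {k : Globe n} (x : NGlob.cell c.pt k) :
    ∃ (j : J) (a : (F.obj j).cells.cell k), inc c j a = x :=
  Types.jointly_surjective_of_isColimit
    (isColimitOfPreserves ((evaluation _ _).obj (op k)) hc) x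

include κ

lemma exists_tr_eq_tr {k : Globe n} {i j : J} {x : (F.obj i).cells.cell k}
    {y : (F.obj j).cells.cell k} (e : inc c i x = inc c j y) :
    ∃ (m : J) (f : i ⟶ m) (g : j ⟶ m), tr F f x = tr F g y :=
  exists_map_eq_map_of_isColimit κ (isColimitOfPreserves ((evaluation _ _).obj (op k)) hc) e

lemma exists_tr_eq {k : Globe n} {i : J} {x y : (F.obj i).cells.cell k}
    (e : inc c i x = inc c i y) : ∃ (m : J) (f : i ⟶ m), tr F f x = tr F f y :=
  exists_map_eq_of_isColimit κ (isColimitOfPreserves ((evaluation _ _).obj (op k)) hc) e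

/-- Serves to add one more composable cell to cells already placed at a stage `i`: the equality in
the colimit joins `i` to the stage of `y` by a cospan. -/
lemma exists_src_eq {k l : Globe n} (h : k.dim < l.dim) {i : J} (t : (F.obj i).cells.cell k)
    (y : NGlob.cell c.pt l) (e : inc c i t = NGlob.src c.pt h y) :
    ∃ (j : J) (f : i ⟶ j) (b : (F.obj j).cells.cell l), inc c j b = y ∧
      tr F f t = (F.obj j).cells.src h b := by
  obtain ⟨i', b, rfl⟩ := exists_inc_eq hc y
  rw [src_inc] at e
  obtain ⟨m, f, g, hfg⟩ := exists_tr_eq_tr κ hc e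
  exact ⟨m, f, tr F g b, inc_tr g b, by rw [tr_src, hfg]⟩

lemma exists_composable {k l : Globe n} (h : k.dim < l.dim) (x y : NGlob.cell c.pt l)
    (e : NGlob.tgt c.pt h x = NGlob.src c.pt h y) :
    ∃ (j : J) (a b : (F.obj j).cells.cell l), inc c j a = x ∧ inc c j b = y ∧
      (F.obj j).cells.tgt h a = (F.obj j).cells.src h b := by
  obtain ⟨i, a, rfl⟩ := exists_inc_eq hc x
  rw [tgt_inc] at e
  obtain ⟨j, f, b, rfl, hb⟩ := exists_src_eq κ hc h _ y e
  exact ⟨j, tr F f a, b, inc_tr f a, rfl, by rw [tr_tgt, hb]⟩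

lemma inc_ident_eq {k l : Globe n} (h : k.dim < l.dim) {i j : J} {x : (F.obj i).cells.cell k}
    {y : (F.obj j).cells.cell k} (e : inc c i x = inc c j y) :
    inc c i ((F.obj i).ident h x) = inc c j ((F.obj j).ident h y) := by
  obtain ⟨m, f, g, hfg⟩ := exists_tr_eq_tr κ hc e
  rw [← inc_tr f, ← inc_tr g ((F.obj j).ident h y), tr_ident, tr_ident, hfg]

/-- Composites do not depend on representatives: a cospan aligns the first factors, and then one
further arrow aligns the second factors without separating the first. -/
lemma inc_comp_eq {k l : Globe n} (h : k.dim < l.dim) {i j : J} {x y : (F.obj i).cells.cell l}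
    {x' y' : (F.obj j).cells.cell l} (e : (F.obj i).cells.tgt h x = (F.obj i).cells.src h y)
    (e' : (F.obj j).cells.tgt h x' = (F.obj j).cells.src h y')
    (hx : inc c i x = inc c j x') (hy : inc c i y = inc c j y') :
    inc c i ((F.obj i).comp h x y e) = inc c j ((F.obj j).comp h x' y' e') := by
  obtain ⟨m, f, g, hfg⟩ := exists_tr_eq_tr κ hc hx
  rw [← inc_tr f, ← inc_tr g y'] at hy
  obtain ⟨p, a, ha⟩ := exists_tr_eq κ hc hy
  rw [← inc_tr f, ← inc_tr a, ← inc_tr g ((F.obj j).comp h x' y' e'),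
    ← inc_tr a (tr F g _), tr_comp, tr_comp, tr_comp, tr_comp]
  exact congrArg _ (comp_congr _ h _ _ (by rw [hfg]) ha)

end

/-- Identities in a colimit. -/
noncomputable def colimitIdent (hc : IsColimit c) {k l : Globe n} (h : k.dim < l.dim)
    (x : NGlob.cell c.pt k) : NGlob.cell c.pt l :=
  inc c _ ((F.obj (exists_inc_eq hc x).choose).ident h (exists_inc_eq hc x).choose_spec.choose)

include κ in
lemma colimitIdent_inc (hc : IsColimit c) {k l : Globe n} (h : k.dim < l.dim) {j : J}
    (a : (F.obj j).cells.cell k) :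
    colimitIdent hc h (inc c j a) = inc c j ((F.obj j).ident h a) :=
  inc_ident_eq κ hc h (exists_inc_eq hc (inc c j a)).choose_spec.choose_spec

/-- Composites in a colimit. -/
noncomputable def colimitComp (hc : IsColimit c) {k l : Globe n} (h : k.dim < l.dim)
    (x y : NGlob.cell c.pt l) (e : NGlob.tgt c.pt h x = NGlob.src c.pt h y) :
    NGlob.cell c.pt l :=
  let H := exists_composable κ hc h x y e
  inc c _ ((F.obj H.choose).comp h H.choose_spec.choose H.choose_spec.choose_spec.choose
    H.choose_spec.choose_spec.choose_spec.2.2)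

lemma colimitComp_eq (hc : IsColimit c) {k l : Globe n} (h : k.dim < l.dim)
    {x y : NGlob.cell c.pt l} (e : NGlob.tgt c.pt h x = NGlob.src c.pt h y) {j : J}
    {a b : (F.obj j).cells.cell l} (e' : (F.obj j).cells.tgt h a = (F.obj j).cells.src h b)
    (ha : inc c j a = x) (hb : inc c j b = y) :
    colimitComp κ hc h x y e = inc c j ((F.obj j).comp h a b e') :=
  let H := exists_composable κ hc h x y e
  inc_comp_eq κ hc h H.choose_spec.choose_spec.choose_spec.2.2 e'
    (H.choose_spec.choose_spec.choose_spec.1.trans ha.symm)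
    (H.choose_spec.choose_spec.choose_spec.2.1.trans hb.symm)

/-- The structure of a strict `n`-category on a c-filtered colimit of strict `n`-categories. -/
noncomputable def colimitNCat (hc : IsColimit c) : StrictNCat.{w} n where
  cells := c.pt
  ident h x := colimitIdent hc h x
  comp h x y e := colimitComp κ hc h x y e
  src_ident h x := by
    obtain ⟨j, a, rfl⟩ := exists_inc_eq hc x
    rw [colimitIdent_inc κ, src_inc, (F.obj j).src_ident]
  tgt_ident h x := by
    obtain ⟨j, a, rfl⟩ := exists_inc_eq hc x
    rw [colimitIdent_inc κ, tgt_inc, (F.obj j).tgt_ident]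
  ident_ident h h' x := by
    obtain ⟨j, a, rfl⟩ := exists_inc_eq hc x
    rw [colimitIdent_inc κ, colimitIdent_inc κ, colimitIdent_inc κ, (F.obj j).ident_ident]
  src_comp h x y e := by
    obtain ⟨j, a, b, rfl, rfl, e'⟩ := exists_composable κ hc h x y e
    rw [colimitComp_eq κ hc h e e' rfl rfl, src_inc, src_inc, (F.obj j).src_comp]
  tgt_comp h x y e := by
    obtain ⟨j, a, b, rfl, rfl, e'⟩ := exists_composable κ hc h x y e
    rw [colimitComp_eq κ hc h e e' rfl rfl, tgt_inc, tgt_inc, (F.obj j).tgt_comp]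
  src_comp_of_lt h h' x y e e₁ := by
    obtain ⟨j, a, b, rfl, rfl, e'⟩ := exists_composable κ hc _ x y e
    have e₁' : (F.obj j).cells.tgt h ((F.obj j).cells.src h' a) =
        (F.obj j).cells.src h ((F.obj j).cells.src h' b) := by
      rw [NGlob.tgt_src, NGlob.src_src, e']
    rw [colimitComp_eq κ hc _ e e' rfl rfl,
      colimitComp_eq κ hc h e₁ e₁' (src_inc ..).symm (src_inc ..).symm, src_inc,
      (F.obj j).src_comp_of_lt]
  tgt_comp_of_lt h h' x y e e₁ := by
    obtain ⟨j, a, b, rfl, rfl, e'⟩ := exists_composable κ hc _ x y e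
    have e₁' : (F.obj j).cells.tgt h ((F.obj j).cells.tgt h' a) =
        (F.obj j).cells.src h ((F.obj j).cells.tgt h' b) := by
      rw [NGlob.tgt_tgt, NGlob.src_tgt, e']
    rw [colimitComp_eq κ hc _ e e' rfl rfl,
      colimitComp_eq κ hc h e₁ e₁' (tgt_inc ..).symm (tgt_inc ..).symm, tgt_inc,
      (F.obj j).tgt_comp_of_lt]
  assoc h x y z e₁ e₂ e₃ e₄ := by
    obtain ⟨i, a, b, rfl, rfl, e₁'⟩ := exists_composable κ hc h x y e₁
    obtain ⟨j, f, d, rfl, e₂'⟩ := exists_src_eq κ hc h _ z ((tgt_inc ..).symm.trans e₂)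
    have e₁'' := tr_composable f h e₁'
    rw [← tr_tgt] at e₂'
    rw [colimitComp_eq κ hc h e₃ (((F.obj j).tgt_comp ..).trans e₂')
        (colimitComp_eq κ hc h e₁ e₁'' (inc_tr f a) (inc_tr f b)).symm rfl,
      colimitComp_eq κ hc h e₄ (e₁''.trans ((F.obj j).src_comp ..).symm) (inc_tr f a)
        (colimitComp_eq κ hc h e₂ e₂' (inc_tr f b) rfl).symm, (F.obj j).assoc]
  ident_comp h x e := by
    obtain ⟨j, a, rfl⟩ := exists_inc_eq hc x
    rw [colimitComp_eq κ hc h e ((F.obj j).tgt_ident h _)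
      (by rw [src_inc, colimitIdent_inc κ]) rfl, (F.obj j).ident_comp]
  comp_ident h x e := by
    obtain ⟨j, a, rfl⟩ := exists_inc_eq hc x
    rw [colimitComp_eq κ hc h e ((F.obj j).src_ident h _).symm rfl
      (by rw [tgt_inc, colimitIdent_inc κ]), (F.obj j).comp_ident]
  interchange {k m l} h h' x y x' y' e₁ e₂ e₃ e₄ e₅ e₆ := by
    -- The overlaps `x`–`y`, `x`–`x'` and `x'`–`y'` form a tree, so the four cells can be brought to
    -- one stage by adding one cell at a time.
    obtain ⟨j, a, b, a', b', rfl, rfl, rfl, rfl, h₁, h₂, h₃⟩ :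
        ∃ (j : J) (a b a' b' : (F.obj j).cells.cell l), inc c j a = x ∧ inc c j b = y ∧
          inc c j a' = x' ∧ inc c j b' = y' ∧
          (F.obj j).cells.tgt h' a = (F.obj j).cells.src h' b ∧
          (F.obj j).cells.tgt h' a' = (F.obj j).cells.src h' b' ∧
          (F.obj j).cells.tgt (h.trans h') a = (F.obj j).cells.src (h.trans h') a' := by
      obtain ⟨j₁, a, b, rfl, rfl, h₁⟩ := exists_composable κ hc h' x y e₁
      obtain ⟨j₂, f, a', rfl, h₃⟩ := exists_src_eq κ hc _ _ x' ((tgt_inc ..).symm.trans e₃)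
      obtain ⟨j, g, b', rfl, h₂⟩ := exists_src_eq κ hc _ _ y' ((tgt_inc ..).symm.trans e₂)
      rw [← tr_tgt] at h₂ h₃
      exact ⟨j, tr F g (tr F f a), tr F g (tr F f b), tr F g a', b',
        (inc_tr ..).trans (inc_tr ..), (inc_tr ..).trans (inc_tr ..), inc_tr .., rfl,
        tr_composable g h' (tr_composable f h' h₁), h₂, tr_composable g _ h₃⟩
    have h₄ := (F.obj j).cells.tgt_eq_src_of_tgt_eq_src h h' h₁ h₂ h₃
    have h₅ : (F.obj j).cells.tgt (h.trans h') ((F.obj j).comp h' a b h₁) =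
        (F.obj j).cells.src (h.trans h') ((F.obj j).comp h' a' b' h₂) := by
      rw [← NGlob.tgt_tgt _ h h', ← NGlob.src_src _ h h', (F.obj j).tgt_comp,
        (F.obj j).src_comp, NGlob.tgt_tgt, NGlob.src_src, ← h₃, ← NGlob.tgt_src _ h h' b, ← h₁,
        NGlob.tgt_tgt]
    have h₆ : (F.obj j).cells.tgt h' ((F.obj j).comp (h.trans h') a a' h₃) =
        (F.obj j).cells.src h' ((F.obj j).comp (h.trans h') b b' h₄) := by
      have h₇ : (F.obj j).cells.tgt h ((F.obj j).cells.tgt h' a) =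
          (F.obj j).cells.src h ((F.obj j).cells.tgt h' a') := by
        rw [NGlob.tgt_tgt, NGlob.src_tgt, h₃]
      rw [(F.obj j).tgt_comp_of_lt h h' a a' h₃ h₇,
        (F.obj j).src_comp_of_lt h h' b b' h₄ (by rw [← h₁, ← h₂, h₇])]
      exact comp_congr _ h _ _ h₁ h₂
    rw [colimitComp_eq κ hc _ e₅ h₅ (colimitComp_eq κ hc h' e₁ h₁ rfl rfl).symm
        (colimitComp_eq κ hc h' e₂ h₂ rfl rfl).symm,
      colimitComp_eq κ hc _ e₆ h₆ (colimitComp_eq κ hc _ e₃ h₃ rfl rfl).symm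
        (colimitComp_eq κ hc _ e₄ h₄ rfl rfl).symm,
      (F.obj j).interchange h h' a b a' b' h₁ h₂ h₃ h₄ h₅ h₆]
  ident_comp_ident h h' x y e e' := by
    obtain ⟨j, a, b, rfl, rfl, e₁⟩ := exists_composable κ hc _ x y e
    have e₂ : (F.obj j).cells.tgt (h.trans h') ((F.obj j).ident h' a) =
        (F.obj j).cells.src (h.trans h') ((F.obj j).ident h' b) := by
      rw [← NGlob.tgt_tgt _ h h', ← NGlob.src_src _ h h', (F.obj j).tgt_ident,
        (F.obj j).src_ident, e₁]
    rw [colimitComp_eq κ hc _ e' e₂ (colimitIdent_inc κ hc h' a).symm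
      (colimitIdent_inc κ hc h' b).symm, colimitComp_eq κ hc h e e₁ rfl rfl,
      colimitIdent_inc κ, (F.obj j).ident_comp_ident]

include κ in
lemma map_colimit_ident (hc : IsColimit c) (D : StrictNCat.{w} n) (φ : c.pt ⟶ D.cells)
    (s : ∀ j, F.obj j ⟶ D)
    (hs : ∀ j, (show (F.obj j).cells ⟶ c.pt from c.ι.app j) ≫ φ = StrictNCat.Hom.map (s j))
    {k l : Globe n} (h : k.dim < l.dim) (x : NGlob.cell c.pt k) :
    φ.app (op l) (colimitIdent hc h x) = D.ident h (φ.app (op k) x) := by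
  have hs' (j : J) {k : Globe n} (a : (F.obj j).cells.cell k) :
      φ.app (op k) (inc c j a) = (StrictNCat.Hom.map (s j)).app (op k) a :=
    congr(NatTrans.app $(hs j) (op k) a)
  obtain ⟨j, a, rfl⟩ := exists_inc_eq hc x
  rw [colimitIdent_inc κ, hs', hs', StrictNCat.Hom.map_ident]

lemma map_colimit_comp (hc : IsColimit c) (D : StrictNCat.{w} n) (φ : c.pt ⟶ D.cells)
    (s : ∀ j, F.obj j ⟶ D)
    (hs : ∀ j, (show (F.obj j).cells ⟶ c.pt from c.ι.app j) ≫ φ = StrictNCat.Hom.map (s j))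
    {k l : Globe n} (h : k.dim < l.dim) (x y : NGlob.cell c.pt l)
    (e : NGlob.tgt c.pt h x = NGlob.src c.pt h y)
    (e' : D.cells.tgt h (φ.app (op l) x) = D.cells.src h (φ.app (op l) y)) :
    φ.app (op l) (colimitComp κ hc h x y e) = D.comp h (φ.app (op l) x) (φ.app (op l) y) e' := by
  have hs' (j : J) {k : Globe n} (a : (F.obj j).cells.cell k) :
      φ.app (op k) (inc c j a) = (StrictNCat.Hom.map (s j)).app (op k) a :=
    congr(NatTrans.app $(hs j) (op k) a)
  obtain ⟨j, a, b, rfl, rfl, e₁⟩ := exists_composable κ hc h x y e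
  rw [colimitComp_eq κ hc h e e₁ rfl rfl, hs',
    StrictNCat.Hom.map_comp (s j) h a b e₁ (NGlob.map_composable _ h e₁)]
  exact comp_congr _ h _ _ (hs' j a).symm (hs' j b).symm

/-- The colimit cocone of strict `n`-categories. -/
noncomputable def colimitNCatCocone (hc : IsColimit c) : Cocone F where
  pt := colimitNCat κ hc
  ι :=
    { app := fun j => StrictNCat.Hom.mk (D := colimitNCat κ hc) (c.ι.app j)
        (fun h x => (colimitIdent_inc κ hc h x).symm)
        (fun h _ _ e e' => (colimitComp_eq κ hc h e' e rfl rfl).symm)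
      naturality := fun _ _ f => StrictNCat.Hom.ext (c.ι.naturality f) }

/-- The cocone `colimitNCatCocone` is a colimit. -/
noncomputable def isColimitColimitNCatCocone (hc : IsColimit c) :
    IsColimit (colimitNCatCocone κ hc) where
  desc s := StrictNCat.Hom.mk (C := colimitNCat κ hc) (hc.desc ((forget n).mapCocone s))
    (fun h x => map_colimit_ident κ hc s.pt _ s.ι.app (hc.fac ((forget n).mapCocone s)) h x)
    (fun h x y e e' => map_colimit_comp κ hc s.pt _ s.ι.app
      (hc.fac ((forget n).mapCocone s)) h x y e e')
  fac s j := StrictNCat.Hom.ext (hc.fac ((forget n).mapCocone s) j)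
  uniq s m hm := StrictNCat.Hom.ext (hc.uniq ((forget n).mapCocone s) (StrictNCat.Hom.map m)
    fun j => congrArg StrictNCat.Hom.map (hm j))

-- The colimit of the underlying globular sets carries a structure that makes it a colimit of strict
-- `n`-categories, so one colimit cocone is preserved, hence all are.
omit c in
include κ in
variable (J n) in
lemma preservesColimitsOfShape_forget : PreservesColimitsOfShape J (forget.{w} n) where
  preservesColimit {F} := preservesColimit_of_preserves_colimit_cocone
    (isColimitColimitNCatCocone κ (colimit.isColimit (F ⋙ forget n)))
    (IsColimit.ofIsoColimit (colimit.isColimit (F ⋙ forget n)) (Cocone.ext (Iso.refl _)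
      fun _ => Category.comp_id _))

end Colimit

end StrictNCat

/-! ### The monads of n-operads -/

section

variable (κ : Cardinal.{w}) [Fact κ.IsRegular] (J : Type w) [SmallCategory J]
  [IsCardinalCFiltered J κ]

include κ in
lemma preservesColimitsOfShape_strictNCatMonad (n : ℕ∞) :
    PreservesColimitsOfShape J (strictNCatMonad.{w} n).toFunctor := by
  have := StrictNCat.preservesColimitsOfShape_forget n κ J
  change PreservesColimitsOfShape J
    ((StrictNCat.forget.{w} n).leftAdjoint ⋙ StrictNCat.forget.{w} n)
  have : PreservesColimitsOfShape J (StrictNCat.forget.{w} n).leftAdjoint :=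
    (Adjunction.ofIsRightAdjoint _).leftAdjoint_preservesColimits.preservesColimitsOfShape
  infer_instance

include κ in
lemma NOperad.preservesColimitsOfShape (A : NOperad.{w} n) :
    PreservesColimitsOfShape J A.monad.toFunctor := by
  have := preservesColimitsOfShape_strictNCatMonad κ J n
  exact preservesColimitsOfShape_of_equifibered κ _ A.cartesian

end

/-! ### Presheaf categories and part (2) -/

section Presheaf

variable {C : Type} [SmallCategory C]

/-- Maps out of a representable presheaf are given by evaluation. -/
def coyonedaUliftYonedaIso (k : C) :
    coyoneda.obj (op (uliftYoneda.{w}.obj k)) ≅ (evaluation Cᵒᵖ (Type w)).obj (op k) :=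
  NatIso.ofComponents fun P => Equiv.toIso uliftYonedaEquiv

lemma isConnectedObject_uliftYoneda (k : C) : IsConnectedObject (uliftYoneda.{w}.obj k) :=
  fun _ => preservesColimitsOfShape_of_natIso (coyonedaUliftYonedaIso k).symm

lemma isStrongGenerator_uliftYoneda :
    (ObjectProperty.ofObj (uliftYoneda.{w} : C ⥤ Cᵒᵖ ⥤ Type w).obj).IsStrongGenerator := by
  rw [ObjectProperty.isStrongGenerator_iff]
  refine ⟨fun X Y f g h => ?_, fun X Y f _ hf => ?_⟩
  · ext k x
    have := h _ (ObjectProperty.ofObj_apply _ k.unop) (uliftYonedaEquiv.symm x)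
    rw [uliftYonedaEquiv_symm_comp, uliftYonedaEquiv_symm_comp] at this
    exact uliftYonedaEquiv.symm.injective this
  · rw [NatTrans.isIso_iff_isIso_app]
    intro k
    rw [isIso_iff_bijective]
    refine ⟨(mono_iff_injective _).1 inferInstance, fun x => ?_⟩
    obtain ⟨y, hy⟩ := hf _ (ObjectProperty.ofObj_apply _ k.unop) (uliftYonedaEquiv.symm x)
    refine ⟨uliftYonedaEquiv y, ?_⟩
    rw [← uliftYonedaEquiv_comp]
    exact (Equiv.eq_symm_apply _).1 hy

/-- Presheaf categories are locally `κ`-c-presentable. -/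
lemma isLocallyCPresentable_presheaf (κ : Cardinal.{w}) [Fact κ.IsRegular] :
    IsLocallyCPresentable (Cᵒᵖ ⥤ Type w) κ := by
  have : Small.{w} C := ⟨ULift.{w} C, ⟨Equiv.ulift.symm⟩⟩
  refine isLocallyCPresentable_of_isStrongGenerator κ isStrongGenerator_uliftYoneda ?_
  rintro _ ⟨k⟩
  exact ⟨isConnectedObject_uliftYoneda k,
    ⟨fun J _ _ => preservesColimitsOfShape_of_natIso (coyonedaUliftYonedaIso k).symm⟩⟩

end Presheaf

/-- The algebras of an `n`-operad form a locally finitely c-presentable category. -/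
theorem NOperad.isLocallyFinitelyCPresentable_algebra (A : NOperad.{w} n) :
    IsLocallyFinitelyCPresentable A.monad.Algebra := by
  have := Cardinal.fact_isRegular_aleph0.{w}
  have : IsLocallyCPresentable (NGlob.{w} n) Cardinal.aleph0.{w} :=
    isLocallyCPresentable_presheaf _
  -- Filtered and discrete shapes are both c-filtered, so `NOperad.preservesColimitsOfShape` yields
  -- this hypothesis and the one on coproducts.
  have : A.monad.toFunctor.IsCardinalAccessible Cardinal.aleph0.{w} := ⟨fun J _ _ => by
    have := isCardinalCFiltered_of_isCardinalFiltered J Cardinal.aleph0.{w}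
    exact A.preservesColimitsOfShape Cardinal.aleph0.{w} J⟩
  exact isLocallyCPresentable_algebra Cardinal.aleph0.{w} A.monad
    fun ι => A.preservesColimitsOfShape Cardinal.aleph0.{w} (Discrete ι)

end Glob

theorem mainTheorem12 :
    (∀ (κ : Cardinal.{w}) [Fact κ.IsRegular] (V : Type u) [Category.{w} V]
      [CPres.IsLocallyCPresentable V κ] (T : Monad V),
      T.toFunctor.IsCardinalAccessible κ →
      CPres.PreservesSmallCoproducts T.toFunctor →
      CPres.IsLocallyCPresentable T.Algebra κ) ∧
    (∀ (n : ℕ∞) (A : Glob.NOperad.{w} n),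
      CPres.IsLocallyFinitelyCPresentable A.monad.Algebra) := by
  exact ⟨fun κ _ V _ _ T hT hT' => CPres.isLocallyCPresentable_algebra κ T hT',
    fun n A => A.isLocallyFinitelyCPresentable_algebra⟩
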